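/- **Theorem (Lower bound of KL divergence for general relevance distribution).** For every integer $k\ge 1$ let there be $k$ branches with $n=n(k)$ items each, nonnegative weights $w_{ij}=w^{(k)}_{ij}$ ($i\in[k]$, $j\in[n]$) with $w_i:=\sum_j w_{ij}>0$ for every $i$, and a sampling probability $p=p(k)\in(0,1)$; put $q=1-p$ and $W=\sum_{i=1}^k w_i$. Let $S_{ij}$ be independent weighted Bernoulli variables, $\Pr[S_{ij}=w_{ij}]=p$ and $\Pr[S_{ij}=0]=q$ if $w_{ij}>0$, and $S_{ij}=0$ almost surely if $w_{ij}=0$. Put $S_i=\sum_j S_{ij}$ and $Z=\sum_{i=1}^k S_i$. Assume: 1. (Lyapunov's condition, uniformly in the branch.) For some $\delta>0$, $$\max_{i\in[k]}\ \frac{pq^{2+2\delta}+p^{2+2\delta}q}{\bigl(\sum_j w_{ij}^2\,pq\bigr)^{1+\delta}}\sum_j w_{ij}^{2+2\delta}\ \longrightarrow\ 0\qquad (k\to\infty).$$ 2. (No dominating branch.) $\sum_{i} w_i^2/W^2\to 0$ as $k\to\infty$. 3. (The sampling probability is not close to one.) There is a constant $p_0<9/10$ with $p(k)\le p_0$ for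 all $k$; for example $p(k)\to 0$ with $p(k)\le p_0$. Define the random distribution $P$ and the distribution $Q$ on $[k]$ by $$P[i]=\frac{S_i}{Z}\ \ (\text{when } Z>0),\qquad Q[i]=\frac{w_i}{W},$$ and let $$A_i=\Bigl(\sum_j \frac{w_{ij}^2}{w_i^2}\Bigr)^{1/2},\qquad \mathbb E[A_i]=\sum_{i=1}^k \frac{w_i}{W}A_i .$$ Then $$\lim_{k\to\infty}\Pr\Bigl[\,Z>0\ \text{ and }\ \mathrm{KL}(P\|Q)=\sum_i P[i]\ln\frac{P[i]}{Q[i]}\ \ge\ \frac{0.05\,\mathbb E^2[A_i]}{p}\Bigr]=1 .$$ Moreover the bound is smallest in the uniform case: for every $k\ge1$, $$\frac{0.05\,\mathbb E^2[A_i]}{p}\ \ge\ \frac{0.05}{n\,p},$$ with equality when all weights $w_{ij}$ are equal to one positive constant. -/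

import Mathlib

open MeasureTheory ProbabilityTheory Filter Topology

noncomputable section

/-- The total weight `w_i = ∑_j w_ij` of branch `i`. -/
def branchWeight {k n : ℕ} (w : Fin k → Fin n → ℝ) (i : Fin k) : ℝ :=
  ∑ j, w i j

/-- The total weight `W = ∑_i w_i` of all branches. -/
def totalWeight {k n : ℕ} (w : Fin k → Fin n → ℝ) : ℝ :=
  ∑ i, branchWeight w i

/-- The root `A_i` of the Simpson index of branch `i`, where `A_i² = ∑_j w_ij² / w_i²`. -/
def simpsonRoot {k n : ℕ} (w : Fin k → Fin n → ℝ) (i : Fin k) : ℝ :=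
  Real.sqrt (∑ j, w i j ^ 2 / branchWeight w i ^ 2)

/-- The expectation `E[A_i] = ∑_i (w_i / W) A_i` of `A_i`, where the branch `i` is drawn with
probability proportional to its weight. -/
def meanSimpsonRoot {k n : ℕ} (w : Fin k → Fin n → ℝ) : ℝ :=
  ∑ i, branchWeight w i / totalWeight w * simpsonRoot w i

/-- The lower bound `0.05 E²[A_i] / p`. -/
def klLowerBound {k n : ℕ} (p : ℝ) (w : Fin k → Fin n → ℝ) : ℝ :=
  0.05 * meanSimpsonRoot w ^ 2 / p

/-- The quotient in Lyapunov's condition with exponent `2 + 2δ` for a sum of independent weighted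
Bernoulli variables with parameter `p` and weights `v_j`. -/
def lyapunovRatio {n : ℕ} (δ p : ℝ) (v : Fin n → ℝ) : ℝ :=
  (p * (1 - p) ^ (2 + 2 * δ) + p ^ (2 + 2 * δ) * (1 - p)) /
    (∑ j, v j ^ 2 * p * (1 - p)) ^ (1 + δ) * ∑ j, v j ^ (2 + 2 * δ)

/-- The probability vector proportional to `x`. -/
def normalizeVec {k : ℕ} (x : Fin k → ℝ) : Fin k → ℝ :=
  fun i => x i / ∑ l, x l

/-- The Kullback-Leibler divergence `∑_i P_i ln (P_i / Q_i)` of two probability vectors such that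
`Q_i > 0` for all `i`; a term with `P_i = 0` is zero. -/
def finiteKL {k : ℕ} (P Q : Fin k → ℝ) : ℝ :=
  ∑ i, P i * Real.log (P i / Q i)

/-- The measure on `Fin k` with point masses `x_i`. -/
def vecMeasure {k : ℕ} (x : Fin k → ℝ) : Measure (Fin k) :=
  ∑ i, ENNReal.ofReal (x i) • Measure.dirac i

theorem vecMeasure_singleton {k : ℕ} (x : Fin k → ℝ) (i : Fin k) :
    vecMeasure x {i} = ENNReal.ofReal (x i) := by
  simp [vecMeasure, Set.indicator_apply, Finset.sum_ite_eq']

/-- `finiteKL` agrees with Mathlib's divergence of measures. -/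
theorem finiteKL_eq_klDiv {k : ℕ} (P Q : Fin k → ℝ) (hP : ∀ i, 0 ≤ P i) (hQ : ∀ i, 0 < Q i)
    (hP1 : ∑ i, P i = 1) (hQ1 : ∑ i, Q i = 1) :
    finiteKL P Q = (InformationTheory.klDiv (vecMeasure P) (vecMeasure Q)).toReal := by
  have hfin : ∀ x : Fin k → ℝ, IsFiniteMeasure (vecMeasure x) := fun x => by
    constructor
    simp [vecMeasure, ENNReal.sum_lt_top]
  have := hfin P
  have := hfin Q
  have huniv : ∀ x : Fin k → ℝ, (∀ i, 0 ≤ x i) → ∑ i, x i = 1 → vecMeasure x Set.univ = 1 := by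
    intro x hx h1
    simp [vecMeasure, ← ENNReal.ofReal_sum_of_nonneg (fun i _ => hx i), h1]
  have hac : vecMeasure P ≪ vecMeasure Q := by
    intro s hs
    have : s = ∅ := by
      by_contra hne
      obtain ⟨i, hi⟩ := Set.nonempty_iff_ne_empty.mpr hne
      have h := measure_mono_null (Set.singleton_subset_iff.mpr hi) hs
      rw [vecMeasure_singleton, ENNReal.ofReal_eq_zero] at h
      exact absurd (hQ i) (not_lt.mpr h)
    simp [this]
  rw [InformationTheory.toReal_klDiv_of_measure_eq hac
    (by rw [huniv P hP hP1, huniv Q (fun i => (hQ i).le) hQ1]),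
    integral_fintype (Integrable.of_finite)]
  refine Finset.sum_congr rfl fun i _ => ?_
  have hd : (vecMeasure P).rnDeriv (vecMeasure Q) i * vecMeasure Q {i} = vecMeasure P {i} := by
    conv_rhs => rw [← Measure.withDensity_rnDeriv_eq _ _ hac]
    rw [withDensity_apply _ (measurableSet_singleton i), lintegral_singleton]
  rw [vecMeasure_singleton, vecMeasure_singleton] at hd
  have hr := congrArg ENNReal.toReal hd
  rw [ENNReal.toReal_mul, ENNReal.toReal_ofReal (hP i), ENNReal.toReal_ofReal (hQ i).le] at hr
  rw [Measure.real, vecMeasure_singleton, ENNReal.toReal_ofReal (hP i), smul_eq_mul, llr,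
    ← hr, mul_div_cancel_right₀ _ (hQ i).ne']

end

/-! Let `X_i = S_i / (p w_i) - 1` be the relative deviation of branch `i`. It has mean zero and
standard deviation `r_i = √((1 - p) / p) A_i`. With `b = ∑ Q_i X_i` there is the exact identity `(1
+ b) KL(P‖Q) = ∑ Q_i klFun (1 + X_i) - klFun (1 + b)` (`finiteKL_normalize_mul`). Since `klFun (1 +
x)` is about `x² / 2` and `b` averages out, the right side should be about `½ ∑ Q_i r_i²`, which is
at least `½ (∑ Q_i r_i)² = (1 - p) / (2p) · E²[A_i]`. For `p ≤ p₀ < 9/10` the factor `(1 - p) / 2`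
exceeds `0.05`, and the gap pays for all errors.

The difficulty is that `∑ Q_i X_i²` need not concentrate: fourth moments are not controlled, and a
few branches with huge `r_i` may dominate. No limit theorem is needed, only the bound `exp (a - t² /
2)` on the characteristic function of `X_i / r_i` for `|t| ≤ T`, which Lyapunov's condition
supplies. It has two consequences. A bounded truncation of `(X_i / r_i)²` has mean at least `1 - ε`
(`exists_le_integral_one_sub_cos`), and `|X_i|` is rarely much smaller than `r_i`
(`exists_measureReal_abs_lt_le`).

With `R = ∑ Q_i r_i`, the branches are split at `r_i = c R`. Below the threshold the truncated
squares concentrate by Chebyshev, because `∑ Q_i²` is small. Above it, the branches have `Q`-mass at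
most `1 / c`; anticoncentration and Cauchy-Schwarz make their contribution at least a large multiple
of the square of their share of `R`, more than is lost by removing them from the other part.
`le_sum_mul_klFun_sub` is this argument for fixed outcomes, and
`exists_le_measureReal_sum_mul_klFun` shows that typical outcomes qualify. -/

open InformationTheory (klFun klFun_apply)

/-! ### Characteristic functions and Lyapunov moments -/

/-- A lower bound of `1 - cos` with an error term of arbitrary order above two. -/
theorem exists_sq_sub_rpow_le_one_sub_cos {a δ : ℝ} (ha : 0 < a) (hδ : 0 < δ) :
    ∃ C : ℝ, 0 ≤ C ∧ ∀ s : ℝ,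
      (1 - a) * s ^ 2 / 2 - C * |s| ^ (2 + 2 * δ) ≤ 1 - Real.cos s := by
  obtain ⟨m, hm, hm1, hma⟩ : ∃ m : ℝ, 0 < m ∧ m ≤ 1 ∧ m ≤ a :=
    ⟨min 1 a, lt_min one_pos ha, min_le_left _ _, min_le_right _ _⟩
  -- With this constant the error term is at least `s²` once `|s| > m`, so the left side is negative
  -- there; for `|s| ≤ m` the quartic Taylor remainder is absorbed by `a s²`.
  refine ⟨m ^ (-(2 * δ)), by positivity, fun s => ?_⟩
  rcases le_or_gt |s| m with hs | hs
  · have hc := Real.cos_bound (hs.trans hm1)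
    have hc' := (abs_le.mp hc).2
    have h4 : |s| ^ 4 ≤ a * s ^ 2 := by
      have : |s| ^ 4 = |s| ^ 2 * s ^ 2 := by rw [← sq_abs s]; ring
      rw [this]
      refine mul_le_mul_of_nonneg_right ?_ (sq_nonneg s)
      have := abs_nonneg s
      nlinarith
    have hnn : 0 ≤ m ^ (-(2 * δ)) * |s| ^ (2 + 2 * δ) := by positivity
    nlinarith [mul_nonneg ha.le (sq_nonneg s)]
  · have hspos : 0 < |s| := hm.trans hs
    have h1 : 1 ≤ m ^ (-(2 * δ)) * |s| ^ (2 * δ) := by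
      rw [Real.rpow_neg hm.le, inv_mul_eq_div, one_le_div (by positivity)]
      exact Real.rpow_le_rpow hm.le hs.le (by positivity)
    have h2 : |s| ^ (2 + 2 * δ) = s ^ 2 * |s| ^ (2 * δ) := by
      rw [Real.rpow_add hspos, Real.rpow_two, sq_abs]
    rw [h2]
    have hc := Real.cos_le_one s
    nlinarith [mul_le_mul_of_nonneg_left h1 (sq_nonneg s), mul_nonneg ha.le (sq_nonneg s),
      sq_nonneg s]

/-- The squared modulus is exactly `1 - 2 p (1 - p) (1 - cos (s (x - y)))`, to which `1 + u ≤ exp u`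
applies. -/
theorem norm_charFun_bernoulliMeasure_le (x y : ℝ) (p : unitInterval) (s : ℝ) :
    ‖charFun (bernoulliMeasure x y p) s‖
      ≤ Real.exp (-(p * (1 - p) * (1 - Real.cos (s * (x - y))))) := by
  have h : charFun (bernoulliMeasure x y p) s
      = (p : ℝ) * Complex.exp ((s * x : ℝ) * Complex.I)
        + ((1 - p : ℝ) : ℂ) * Complex.exp ((s * y : ℝ) * Complex.I) := by
    rw [charFun_apply_real, integral_bernoulliMeasure]
    simp
  have hsq : ‖charFun (bernoulliMeasure x y p) s‖ ^ 2
      = 1 - 2 * (p * (1 - p) * (1 - Real.cos (s * (x - y)))) := by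
    rw [h, Complex.exp_mul_I, Complex.exp_mul_I, ← Complex.ofReal_cos, ← Complex.ofReal_sin,
      ← Complex.ofReal_cos, ← Complex.ofReal_sin, Complex.sq_norm, Complex.normSq_apply,
      mul_sub s, Real.cos_sub]
    simp only [Complex.add_re, Complex.mul_re, Complex.ofReal_re, Complex.ofReal_im,
      Complex.add_im, Complex.mul_im, Complex.I_re, Complex.I_im]
    linear_combination (p : ℝ) ^ 2 * Real.sin_sq_add_cos_sq (s * x)
      + (1 - p : ℝ) ^ 2 * Real.sin_sq_add_cos_sq (s * y)
  refine (sq_le_sq₀ (norm_nonneg _) (Real.exp_pos _).le).mp ?_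
  rw [hsq, ← Real.exp_nat_mul]
  have := Real.add_one_le_exp (((2 : ℕ) : ℝ) * -(p * (1 - p) * (1 - Real.cos (s * (x - y)))))
  push_cast at this ⊢
  linarith

/-- If moments of higher order of weighted Bernoulli variables with total variance one are small,
then the exponent that bounds the characteristic function of their sum is almost that of the normal
distribution. -/
theorem exists_sum_one_sub_cos_ge {δ a : ℝ} (hδ : 0 < δ) (ha : 0 < a) (T : ℝ) :
    ∃ ε : ℝ, 0 < ε ∧ ∀ {ι : Type} [Fintype ι] (b : ℝ) (u : ι → ℝ), 0 ≤ b → (∀ j, 0 ≤ u j) →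
      b * ∑ j, u j ^ 2 = 1 → b * ∑ j, u j ^ (2 + 2 * δ) ≤ ε →
      ∀ t : ℝ, |t| ≤ T → t ^ 2 / 2 - a ≤ ∑ j, b * (1 - Real.cos (t * u j)) := by
  have hT' : 0 < T ^ 2 + 1 := by positivity
  obtain ⟨C, hC, hcos⟩ := exists_sq_sub_rpow_le_one_sub_cos (a := a / (T ^ 2 + 1)) (by positivity) hδ
  have hD : 0 < C * |T| ^ (2 + 2 * δ) + 1 := by positivity
  -- The allowance `a` is shared equally between the loss in the quadratic coefficient and the
  -- higher moment.
  refine ⟨a / 2 / (C * |T| ^ (2 + 2 * δ) + 1), by positivity, fun b u hb hu h2 hδ' t ht => ?_⟩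
  have hterm : ∀ j, b * ((1 - a / (T ^ 2 + 1)) * (t * u j) ^ 2 / 2
      - C * (|t| ^ (2 + 2 * δ) * u j ^ (2 + 2 * δ))) ≤ b * (1 - Real.cos (t * u j)) := fun j => by
    have := hcos (t * u j)
    rw [abs_mul, abs_of_nonneg (hu j), Real.mul_rpow (abs_nonneg t) (hu j)] at this
    exact mul_le_mul_of_nonneg_left this hb
  refine le_trans ?_ (Finset.sum_le_sum fun j _ => hterm j)
  have hsum : ∑ j, b * ((1 - a / (T ^ 2 + 1)) * (t * u j) ^ 2 / 2
      - C * (|t| ^ (2 + 2 * δ) * u j ^ (2 + 2 * δ)))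
      = (1 - a / (T ^ 2 + 1)) * t ^ 2 / 2 * (b * ∑ j, u j ^ 2)
        - C * |t| ^ (2 + 2 * δ) * (b * ∑ j, u j ^ (2 + 2 * δ)) := by
    simp only [Finset.mul_sum, ← Finset.sum_sub_distrib]
    exact Finset.sum_congr rfl fun j _ => by ring
  rw [hsum, h2]
  have hTT : t ^ 2 ≤ T ^ 2 := sq_le_sq' (abs_le.mp ht).1 (abs_le.mp ht).2
  have e1 : a / (T ^ 2 + 1) * t ^ 2 ≤ a := by
    rw [div_mul_eq_mul_div, div_le_iff₀ hT']
    nlinarith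
  have hpow : |t| ^ (2 + 2 * δ) ≤ |T| ^ (2 + 2 * δ) :=
    Real.rpow_le_rpow (abs_nonneg t) (ht.trans (le_abs_self T)) (by positivity)
  have e2 : C * |t| ^ (2 + 2 * δ) * (b * ∑ j, u j ^ (2 + 2 * δ)) ≤ a / 2 := by
    have hnn : 0 ≤ b * ∑ j, u j ^ (2 + 2 * δ) :=
      mul_nonneg hb (Finset.sum_nonneg fun j _ => Real.rpow_nonneg (hu j) _)
    calc C * |t| ^ (2 + 2 * δ) * (b * ∑ j, u j ^ (2 + 2 * δ))
        ≤ (C * |T| ^ (2 + 2 * δ) + 1) * (a / 2 / (C * |T| ^ (2 + 2 * δ) + 1)) := by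
          refine mul_le_mul ?_ hδ' hnn hD.le
          nlinarith [mul_le_mul_of_nonneg_left hpow hC]
      _ = a / 2 := by field_simp
  nlinarith

/-- If moments of higher order of weighted Bernoulli variables with total variance one are small,
then their total mean is large. -/
theorem exists_le_sum_of_rpow_sum_le {δ ρ : ℝ} (hδ : 0 < δ) (hρ : 0 < ρ) :
    ∃ ε : ℝ, 0 < ε ∧ ∀ {ι : Type} [Fintype ι] (b : ℝ) (u : ι → ℝ), 0 ≤ b → (∀ j, 0 ≤ u j) →
      b * ∑ j, u j ^ 2 = 1 → b * ∑ j, u j ^ (2 + 2 * δ) ≤ ε → 1 ≤ ρ * (b * ∑ j, u j) := by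
  have hm : 0 < ρ / 2 := by positivity
  refine ⟨(ρ / 2) ^ (2 * δ) / 2, by positivity, fun b u hb hu h2 hδ' => ?_⟩
  -- The first term covers `u j ≤ ρ / 2`, the second covers larger values. After summation the
  -- second contributes at most `1 / 2` of the total variance one.
  have hterm : ∀ j, u j ^ 2 ≤ ρ / 2 * u j + (ρ / 2) ^ (-(2 * δ)) * u j ^ (2 + 2 * δ) := fun j => by
    rcases le_or_gt (u j) (ρ / 2) with h | h
    · have : 0 ≤ (ρ / 2) ^ (-(2 * δ)) * u j ^ (2 + 2 * δ) :=
        mul_nonneg (by positivity) (Real.rpow_nonneg (hu j) _)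
      nlinarith [mul_le_mul_of_nonneg_right h (hu j)]
    · have hpos : 0 < u j := hm.trans h
      have h1 : 1 ≤ (ρ / 2) ^ (-(2 * δ)) * u j ^ (2 * δ) := by
        rw [Real.rpow_neg hm.le, inv_mul_eq_div, one_le_div (by positivity)]
        exact Real.rpow_le_rpow hm.le h.le (by positivity)
      rw [Real.rpow_add hpos, Real.rpow_two]
      nlinarith [mul_le_mul_of_nonneg_left h1 (sq_nonneg (u j)), mul_pos hm hpos]
  have hsum := mul_le_mul_of_nonneg_left (Finset.sum_le_sum fun j (_ : j ∈ Finset.univ) => hterm j) hb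
  rw [h2, Finset.sum_add_distrib, ← Finset.mul_sum, ← Finset.mul_sum] at hsum
  have h3 : (ρ / 2) ^ (-(2 * δ)) * (b * ∑ j, u j ^ (2 + 2 * δ)) ≤ 1 / 2 := by
    calc _ ≤ (ρ / 2) ^ (-(2 * δ)) * ((ρ / 2) ^ (2 * δ) / 2) :=
          mul_le_mul_of_nonneg_left hδ' (by positivity)
      _ = 1 / 2 := by
          rw [Real.rpow_neg hm.le]
          field_simp
  nlinarith

/-! ### Anticoncentration and truncated second moments from characteristic functions -/

/-- Fubini, and the Gaussian characteristic function is again Gaussian. The right side is a smooth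
bump of width `η` at zero, so averages of the characteristic function control the mass of `ν` near
zero. -/
theorem integral_charFun_gaussianReal (ν : Measure ℝ) [IsProbabilityMeasure ν] (η : ℝ) :
    ∫ s, charFun ν (s / η) ∂(gaussianReal 0 1)
      = ((∫ x, Real.exp (-(x / η) ^ 2 / 2) ∂ν : ℝ) : ℂ) := by
  have hint : Integrable (Function.uncurry fun s x : ℝ => Complex.exp ((s / η : ℝ) * x * Complex.I))
      ((gaussianReal 0 1).prod ν) := by
    refine (integrable_const (1 : ℝ)).mono' (by fun_prop) (ae_of_all _ fun z => ?_)
    rw [Function.uncurry_apply_pair, ← Complex.ofReal_mul, Complex.norm_exp_ofReal_mul_I]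
  simp only [charFun_apply_real]
  rw [integral_integral_swap hint, ← integral_complex_ofReal]
  refine integral_congr_ae (ae_of_all _ fun x => ?_)
  have h := charFun_gaussianReal (μ := 0) (v := 1) (x / η)
  rw [charFun_apply_real] at h
  have hl : (∫ s : ℝ, Complex.exp ((s / η : ℝ) * x * Complex.I) ∂(gaussianReal 0 1))
      = ∫ s : ℝ, Complex.exp ((x / η : ℝ) * s * Complex.I) ∂(gaussianReal 0 1) := by
    congr 1
    ext s
    push_cast
    ring_nf
  simp only
  rw [hl, h]
  push_cast
  congr 1
  simp
  ring

/-- A characteristic function bounded by that of the normal distribution on a long interval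
forces small probabilities of small neighbourhoods of zero. -/
theorem exists_measureReal_abs_lt_le {θ : ℝ} (hθ : 0 < θ) :
    ∃ η : ℝ, 0 < η ∧ ∃ T : ℝ, ∀ ν : Measure ℝ, IsProbabilityMeasure ν →
      (∀ t, |t| ≤ T → ‖charFun ν t‖ ≤ Real.exp (1 - t ^ 2 / 2)) →
      ν.real {x | |x| < η} ≤ θ := by
  set γ : Measure ℝ := gaussianReal 0 1
  -- Three errors of size `θ'` occur, and comparing the bump with the indicator costs a factor `exp
  -- (1 / 2)`; the total is `3θ / 4`.
  set θ' : ℝ := θ / (Real.exp (1 / 2) * 4)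
  have hθ' : 0 < θ' := by positivity
  -- the standard normal distribution has little mass near zero
  have h0 : Tendsto (fun m : ℕ => γ.real {x : ℝ | |x| ≤ 1 / ((m : ℝ) + 1)}) atTop (𝓝 0) := by
    have := tendsto_measure_iInter_atTop (μ := γ)
      (s := fun m : ℕ => {x : ℝ | |x| ≤ 1 / ((m : ℝ) + 1)})
      (fun m => (measurableSet_le (by fun_prop) (by fun_prop)).nullMeasurableSet)
      (fun m m' h x hx => le_trans (Set.mem_ofPred.mp hx) (Nat.one_div_le_one_div h))
      ⟨0, measure_ne_top _ _⟩
    have hset : (⋂ m : ℕ, {x : ℝ | |x| ≤ 1 / ((m : ℝ) + 1)}) = {0} := by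
      ext x
      simp only [Set.mem_iInter, Set.mem_ofPred_eq, Set.mem_singleton_iff]
      refine ⟨fun h => ?_, fun h m => by rw [h, abs_zero]; positivity⟩
      by_contra hx
      obtain ⟨m, hm⟩ := exists_nat_one_div_lt (abs_pos.mpr hx)
      exact absurd (h m) (not_le.mpr hm)
    have hna : NullSingletonClass γ := nullSingletonClass_gaussianReal one_ne_zero
    rw [hset, measure_singleton] at this
    exact (ENNReal.tendsto_toReal ENNReal.zero_ne_top).comp this
  have hinf : Tendsto (fun m : ℕ => γ.real {x : ℝ | (m : ℝ) < |x|}) atTop (𝓝 0) := by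
    have := tendsto_measure_iInter_atTop (μ := γ) (s := fun m : ℕ => {x : ℝ | (m : ℝ) < |x|})
      (fun m => (measurableSet_lt (by fun_prop) (by fun_prop)).nullMeasurableSet)
      (fun m m' h x hx => lt_of_le_of_lt (Nat.cast_le.mpr h) (Set.mem_ofPred.mp hx))
      ⟨0, measure_ne_top _ _⟩
    have hset : (⋂ m : ℕ, {x : ℝ | (m : ℝ) < |x|}) = ∅ := by
      ext x
      simp only [Set.mem_iInter, Set.mem_ofPred_eq, Set.mem_empty_iff_false, iff_false, not_forall,
        not_lt]
      exact exists_nat_ge |x|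
    rw [hset, measure_empty] at this
    exact (ENNReal.tendsto_toReal ENNReal.zero_ne_top).comp this
  obtain ⟨m, hm⟩ := (h0.eventually (gt_mem_nhds hθ')).exists
  obtain ⟨M, hM⟩ := (hinf.eventually (gt_mem_nhds hθ')).exists
  set d : ℝ := 1 / ((m : ℝ) + 1)
  have hd : 0 < d := by positivity
  -- a scale at which the normal characteristic function is small outside `[-d, d]`
  obtain ⟨η, hη, hηd⟩ : ∃ η : ℝ, 0 < η ∧ Real.exp (1 - (d / η) ^ 2 / 2) ≤ θ' := by
    have ht : Tendsto (fun m : ℕ => Real.exp (1 - (d * m) ^ 2 / 2)) atTop (𝓝 0) := by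
      refine Real.tendsto_exp_atBot.comp (tendsto_atBot_add_const_left _ 1 ?_)
      refine tendsto_neg_atTop_atBot.comp (Tendsto.atTop_div_const two_pos ?_)
      exact (tendsto_pow_atTop two_ne_zero).comp (tendsto_natCast_atTop_atTop.const_mul_atTop hd)
    obtain ⟨N, hN, hN1⟩ := ((ht.eventually (gt_mem_nhds hθ')).and (eventually_ge_atTop 1)).exists
    refine ⟨1 / N, by positivity, ?_⟩
    simpa using hN.le
  refine ⟨η, hη, M / η, fun ν hν hch => ?_⟩
  have hnorm : ∀ t, ‖charFun ν t‖ ≤ 1 := norm_charFun_le_one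
  -- The trivial bound one is used for `|s| ≤ d` and `|s| > M`, which have small Gaussian mass. In
  -- between, `|s / η| ≤ M / η` lets the hypothesis apply, and `d / η` is large enough to make its
  -- bound small.
  have hbound : ∀ s, ‖charFun ν (s / η)‖ ≤ {x : ℝ | |x| ≤ d}.indicator (fun _ => (1 : ℝ)) s
      + {x : ℝ | (M : ℝ) < |x|}.indicator (fun _ => (1 : ℝ)) s + θ' := fun s => by
    have i1 : 0 ≤ {x : ℝ | |x| ≤ d}.indicator (fun _ => (1 : ℝ)) s :=
      Set.indicator_nonneg (fun _ _ => zero_le_one) _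
    have i2 : 0 ≤ {x : ℝ | (M : ℝ) < |x|}.indicator (fun _ => (1 : ℝ)) s :=
      Set.indicator_nonneg (fun _ _ => zero_le_one) _
    have hn := hnorm (s / η)
    by_cases hs : |s| ≤ d
    · rw [Set.indicator_of_mem (by exact hs)]
      linarith
    by_cases hs' : (M : ℝ) < |s|
    · rw [Set.indicator_of_mem (s := {x : ℝ | (M : ℝ) < |x|}) hs']
      linarith
    have := hch (s / η) (by rw [abs_div, abs_of_pos hη]; gcongr; exact not_lt.mp hs')
    have h2 : Real.exp (1 - (s / η) ^ 2 / 2) ≤ Real.exp (1 - (d / η) ^ 2 / 2) := by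
      have : (d / η) ^ 2 ≤ (s / η) ^ 2 := by
        rw [← sq_abs (s / η), abs_div, abs_of_pos hη]
        have := (not_le.mp hs).le
        gcongr
      gcongr
    linarith
  have hm1 : MeasurableSet {x : ℝ | |x| ≤ d} := measurableSet_le (by fun_prop) (by fun_prop)
  have hm2 : MeasurableSet {x : ℝ | (M : ℝ) < |x|} := measurableSet_lt (by fun_prop) (by fun_prop)
  have hE : ∫ x, Real.exp (-(x / η) ^ 2 / 2) ∂ν ≤ 3 * θ' := by
    have h1 : ∫ x, Real.exp (-(x / η) ^ 2 / 2) ∂ν ≤ ∫ s, ‖charFun ν (s / η)‖ ∂γ := by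
      calc _ ≤ ‖((∫ x, Real.exp (-(x / η) ^ 2 / 2) ∂ν : ℝ) : ℂ)‖ := by
            rw [Complex.norm_real]; exact le_abs_self _
        _ ≤ _ := by
            rw [← integral_charFun_gaussianReal]
            exact norm_integral_le_integral_norm _
    have hi1 : Integrable ({x : ℝ | |x| ≤ d}.indicator (fun _ => (1 : ℝ))) γ :=
      (integrable_const _).indicator hm1
    have hi2 : Integrable ({x : ℝ | (M : ℝ) < |x|}.indicator (fun _ => (1 : ℝ))) γ :=
      (integrable_const _).indicator hm2
    have h2 := integral_mono_of_nonneg (ae_of_all γ fun s => norm_nonneg (charFun ν (s / η)))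
      ((hi1.add hi2).add (integrable_const θ')) (ae_of_all _ hbound)
    have h3 : ∫ s, ((({x : ℝ | |x| ≤ d}.indicator fun _ => (1 : ℝ))
        + {x : ℝ | (M : ℝ) < |x|}.indicator fun _ => (1 : ℝ)) + fun _ : ℝ => θ') s ∂γ
        = γ.real {x : ℝ | |x| ≤ d} + γ.real {x : ℝ | (M : ℝ) < |x|} + θ' := by
      rw [integral_add' (hi1.add hi2) (integrable_const _), integral_add' hi1 hi2,
        integral_indicator_const _ hm1, integral_indicator_const _ hm2]
      simp
    linarith
  have hmk : Real.exp (-(1 / 2)) * ν.real {x | |x| < η} ≤ ∫ x, Real.exp (-(x / η) ^ 2 / 2) ∂ν := by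
    have hint : Integrable (fun x : ℝ => Real.exp (-(x / η) ^ 2 / 2)) ν := by
      refine (integrable_const (1 : ℝ)).mono' (by fun_prop) (ae_of_all _ fun x => ?_)
      rw [Real.norm_eq_abs, Real.abs_exp, Real.exp_le_one_iff]
      nlinarith [sq_nonneg (x / η)]
    refine le_trans ?_ (mul_meas_ge_le_integral_of_nonneg
      (ae_of_all _ fun x => (Real.exp_pos _).le) hint (Real.exp (-(1 / 2))))
    refine mul_le_mul_of_nonneg_left (measureReal_mono fun x hx => ?_) (Real.exp_pos _).le
    have : (x / η) ^ 2 ≤ 1 := by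
      rw [← sq_abs, abs_div, abs_of_pos hη]
      exact pow_le_one₀ (by positivity) ((div_le_one hη).mpr (Set.mem_ofPred.mp hx).le)
    refine Set.mem_ofPred.mpr (Real.exp_le_exp.mpr ?_)
    linarith
  have h5 : Real.exp (-(1 / 2)) * ν.real {x | |x| < η} ≤ 3 * θ' := hmk.trans hE
  rw [Real.exp_neg, inv_mul_le_iff₀ (Real.exp_pos _)] at h5
  have h6 : Real.exp (1 / 2) * (3 * θ') = 3 / 4 * θ := by
    simp only [θ']
    field_simp
  linarith

/-- A characteristic function bounded by that of the normal distribution forces a second moment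
of a truncation close to one. -/
theorem exists_le_integral_one_sub_cos {ε : ℝ} (hε : 0 < ε) (hε1 : ε ≤ 1) :
    ∃ t : ℝ, 0 < t ∧ ∃ a : ℝ, 0 < a ∧ ∀ ν : Measure ℝ, IsProbabilityMeasure ν →
      ‖charFun ν t‖ ≤ Real.exp (a - t ^ 2 / 2) →
      1 - ε ≤ ∫ x, 2 * (1 - Real.cos (t * x)) / t ^ 2 ∂ν := by
  -- With `t² = ε` the hypothesis gives `E cos (tX) ≤ exp (ε² / 4 - ε / 2) ≤ 1 - ε / 2 + ε² / 2`,
  -- and `2 (1 - E cos (tX)) / ε` is then at least `1 - ε`.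
  refine ⟨√ε, Real.sqrt_pos.mpr hε, ε ^ 2 / 4, by positivity, fun ν hν h => ?_⟩
  set t := √ε
  have ht2 : t ^ 2 = ε := Real.sq_sqrt hε.le
  have hic : Integrable (fun x => Real.cos (t * x)) ν :=
    (integrable_const (1 : ℝ)).mono' (by fun_prop) (ae_of_all _ fun x => by
      rw [Real.norm_eq_abs]; exact Real.abs_cos_le_one _)
  have hcos : ∫ x, Real.cos (t * x) ∂ν ≤ ‖charFun ν t‖ := by
    refine le_trans (le_of_eq ?_) (Complex.re_le_norm _)
    rw [charFun_apply_real]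
    have hi : Integrable (fun x : ℝ => Complex.exp (t * x * Complex.I)) ν :=
      (integrable_const (1 : ℝ)).mono' (by fun_prop) (ae_of_all _ fun x => by
        rw [← Complex.ofReal_mul, Complex.norm_exp_ofReal_mul_I])
    have := integral_re hi
    simp only [RCLike.re_to_complex] at this
    rw [← this]
    refine integral_congr_ae (ae_of_all _ fun x => ?_)
    simp only
    rw [← Complex.ofReal_mul, Complex.exp_ofReal_mul_I_re]
  have hexp : Real.exp (ε ^ 2 / 4 - t ^ 2 / 2) ≤ 1 - ε / 2 + ε ^ 2 / 2 := by
    rw [ht2]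
    set u := ε / 2 - ε ^ 2 / 4 with hu
    have hu0 : 0 ≤ u := by rw [hu]; nlinarith
    have hu1 : u ≤ ε / 2 := by rw [hu]; nlinarith
    have h1 : Real.exp (ε ^ 2 / 4 - ε / 2) ≤ 1 - u + u ^ 2 := by
      rw [show ε ^ 2 / 4 - ε / 2 = -u by rw [hu]; ring, Real.exp_neg]
      refine inv_le_of_inv_le₀ (by nlinarith) ?_
      refine le_trans ?_ (Real.add_one_le_exp u)
      rw [inv_le_iff_one_le_mul₀ (by nlinarith)]
      nlinarith [pow_nonneg hu0 3]
    have h2 : u ^ 2 ≤ ε ^ 2 / 4 := by nlinarith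
    linarith
  have hval : ∫ x, 2 * (1 - Real.cos (t * x)) / t ^ 2 ∂ν
      = 2 * (1 - ∫ x, Real.cos (t * x) ∂ν) / ε := by
    rw [ht2, integral_div, integral_const_mul, integral_sub (integrable_const _) hic]
    simp
  rw [hval, le_div_iff₀ hε]
  nlinarith

/-! ### Quadratic bounds of `klFun` and the identity for the divergence -/

theorem klFun_one_add_le_sq {x : ℝ} (hx : -1 ≤ x) : klFun (1 + x) ≤ x ^ 2 := by
  rw [klFun_apply]
  rcases hx.eq_or_lt with rfl | hx
  · norm_num
  have := Real.log_le_sub_one_of_pos (show 0 < 1 + x by linarith)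
  nlinarith

theorem sq_div_le_klFun_of_nonneg {x : ℝ} (hx : 0 ≤ x) : x ^ 2 / (2 + x) ≤ klFun (1 + x) := by
  have h := mul_le_mul_of_nonneg_left (Real.le_log_one_add_of_nonneg hx)
    (show 0 ≤ 1 + x by linarith)
  have e : x ^ 2 / (2 + x) = (1 + x) * (2 * x / (x + 2)) - x := by
    field_simp
    ring
  rw [klFun_apply, e]
  linarith

/-- The difference `klFun y - (y - 1)² / 2` vanishes at `y = 1` and has derivative `log y - (y - 1)
≤ 0`. -/
theorem sq_div_two_le_klFun_of_nonpos {x : ℝ} (hx : -1 ≤ x) (hx0 : x ≤ 0) :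
    x ^ 2 / 2 ≤ klFun (1 + x) := by
  have hcont : ContinuousOn (fun y => klFun y - (y - 1) ^ 2 / 2) (Set.Icc 0 1) :=
    (InformationTheory.continuous_klFun.sub (by fun_prop)).continuousOn
  have hanti : AntitoneOn (fun y => klFun y - (y - 1) ^ 2 / 2) (Set.Icc 0 1) := by
    refine antitoneOn_of_deriv_nonpos (convex_Icc 0 1) hcont ?_ ?_
    · intro y hy
      rw [interior_Icc] at hy
      exact ((InformationTheory.hasDerivAt_klFun hy.1.ne').differentiableAt.sub
        (by fun_prop)).differentiableWithinAt
    · intro y hy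
      rw [interior_Icc] at hy
      have h2 : HasDerivAt (fun y : ℝ => (y - 1) ^ 2 / 2) (y - 1) y := by
        have := (((hasDerivAt_id y).sub_const 1).pow 2).div_const 2
        convert! this using 1
        simp
      have := (InformationTheory.hasDerivAt_klFun hy.1.ne').sub h2
      rw [show (fun y => klFun y - (y - 1) ^ 2 / 2) = klFun - fun y => (y - 1) ^ 2 / 2 from rfl,
        this.deriv]
      linarith [Real.log_le_sub_one_of_pos hy.1]
  have := hanti (a := 1 + x) (b := 1) ⟨by linarith, by linarith⟩ ⟨zero_le_one, le_rfl⟩ (by linarith)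
  simp only [InformationTheory.klFun_one] at this
  have e : (1 + x - 1) ^ 2 / 2 = x ^ 2 / 2 := by ring
  rw [e] at this
  linarith

/-- For large positive `x`, `klFun (1 + x)` grows more slowly than `x²`, so only a square truncated
at `ρ²` can be bounded with a constant close to `1 / 2`. -/
theorem div_le_klFun_one_add {x y ρ : ℝ} (hx : -1 ≤ x) (hρ : 0 ≤ ρ) (hyx : y ≤ x ^ 2)
    (hyρ : y ≤ ρ ^ 2) : y / (2 + ρ) ≤ klFun (1 + x) := by
  rcases le_total x 0 with h | h
  · refine le_trans ?_ (sq_div_two_le_klFun_of_nonpos hx h)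
    calc y / (2 + ρ) ≤ x ^ 2 / (2 + ρ) := by gcongr
      _ ≤ x ^ 2 / 2 := by gcongr; linarith
  · refine le_trans ?_ (sq_div_le_klFun_of_nonneg h)
    rw [div_le_div_iff₀ (by linarith) (by linarith)]
    rcases le_total x ρ with h' | h'
    · nlinarith [sq_nonneg x]
    · nlinarith [mul_nonneg h hρ]

/-- The divergence from `Q` of the normalization of `x_i = m Q_i (1 + y_i)`, in terms of the
relative deviations `y_i`. -/
theorem finiteKL_normalize_mul {k : ℕ} (Q y : Fin k → ℝ) (m : ℝ) (hm : 0 < m)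
    (hQ : ∀ i, 0 < Q i) (hQ1 : ∑ i, Q i = 1) (hy : -1 < ∑ i, Q i * y i) :
    (1 + ∑ i, Q i * y i) * finiteKL (normalizeVec fun i => m * Q i * (1 + y i)) Q
      = ∑ i, Q i * klFun (1 + y i) - klFun (1 + ∑ i, Q i * y i) := by
  set b := ∑ i, Q i * y i with hb
  have hsum : ∑ i, m * Q i * (1 + y i) = m * (1 + b) := by
    rw [show m * (1 + b) = m * (∑ i, Q i + ∑ i, Q i * y i) by rw [hQ1, hb],
      ← Finset.sum_add_distrib, Finset.mul_sum]
    exact Finset.sum_congr rfl fun i _ => by ring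
  have hb0 : 0 < 1 + b := by linarith
  have hterm : ∀ i, (1 + b) * (normalizeVec (fun i => m * Q i * (1 + y i)) i
      * Real.log (normalizeVec (fun i => m * Q i * (1 + y i)) i / Q i))
      = Q i * klFun (1 + y i) + Q i * y i - (Q i + Q i * y i) * Real.log (1 + b) := fun i => by
    have h1 : normalizeVec (fun i => m * Q i * (1 + y i)) i = Q i * (1 + y i) / (1 + b) := by
      simp only [normalizeVec, hsum]
      field_simp
    have h2 : Q i * (1 + y i) / (1 + b) / Q i = (1 + y i) / (1 + b) := by
      have := (hQ i).ne'
      field_simp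
    rw [h1, h2, klFun_apply]
    by_cases h0 : 1 + y i = 0
    · have : y i = -1 := by linarith
      simp [this]
    · rw [Real.log_div h0 hb0.ne']
      field_simp
      ring
  rw [finiteKL, Finset.mul_sum, Finset.sum_congr rfl fun i _ => hterm i, Finset.sum_sub_distrib,
    Finset.sum_add_distrib, ← Finset.sum_mul, Finset.sum_add_distrib, hQ1, ← hb, klFun_apply]
  ring

/-! ### The deterministic lower bound on typical outcomes -/

/-- Here `b` is the share of `R` from branches above the threshold. Removing it from the main part
costs at most about `2Rb`, which `εR² + b² / ε` dominates. -/
theorem sq_mul_le_of_share {ε R b : ℝ} (hε : 0 < ε) (hε1 : ε ≤ 1) (hR : 0 ≤ R) (hb : 0 ≤ b) :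
    (1 / 2 - 4 * ε) * R ^ 2 ≤ ((1 - ε) * (R - b) ^ 2 - ε * R ^ 2) / (2 + ε)
      + 1 / ε * b ^ 2 - ε * R ^ 2 := by
  have hA : 2 * R * b - ε * R ^ 2 ≤ 1 / ε * b ^ 2 := by
    rw [one_div_mul_eq_div, le_div_iff₀ hε]
    nlinarith [sq_nonneg (b - ε * R)]
  have hB : (1 / 2 - 2 * ε) * R ^ 2 - 2 * R * b
      ≤ ((1 - ε) * (R - b) ^ 2 - ε * R ^ 2) / (2 + ε) := by
    rw [le_div_iff₀ (by linarith)]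
    have h1 := mul_nonneg (sub_nonneg.mpr hε1) (sq_nonneg b)
    have h2 := mul_nonneg hR hb
    have h3 := mul_nonneg hε.le h2
    have h4 := mul_nonneg hε.le (sq_nonneg R)
    have h5 := mul_nonneg hε.le h4
    linear_combination h1 + 2 * h2 + 4 * h3 + 3 / 2 * h4 + 2 * h5
  linarith

/-- The lower bound of the divergence on the event where the deviations behave typically. -/
theorem le_sum_mul_klFun_sub {ι : Type*} [Fintype ι] (Q r x G : ι → ℝ) {K c η ε : ℝ}
    (hQ : ∀ i, 0 ≤ Q i) (hQ1 : ∑ i, Q i = 1) (hr : ∀ i, 0 ≤ r i) (hR : 0 < ∑ i, Q i * r i)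
    (hK : 0 < K) (hη : 0 < η) (hε : 0 < ε) (hε1 : ε ≤ 1)
    (hc : 4 * (2 + ε) * (K + 1 / ε) ≤ c * η ^ 2)
    (hs : K * c ^ 2 * ∑ i, Q i ^ 2 ≤ ε)
    (hx : ∀ i, -1 ≤ x i) (hGx : ∀ i, r i ^ 2 * G i ≤ x i ^ 2) (hGε : ∀ i, r i ^ 2 * G i ≤ ε ^ 2)
    (hηε : ∀ i, r i * η ≤ ε)
    (hb1 : -1 ≤ ∑ i, Q i * x i)
    (h1 : (∑ i, Q i * x i) ^ 2 ≤ K * ∑ i, Q i ^ 2 * r i ^ 2)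
    (h2 : (1 - ε) * ∑ i with r i ≤ c * ∑ l, Q l * r l, Q i * r i ^ 2 - ε * (∑ i, Q i * r i) ^ 2
      ≤ ∑ i with r i ≤ c * ∑ l, Q l * r l, Q i * r i ^ 2 * G i)
    (h3 : (∑ i with ¬ r i ≤ c * ∑ l, Q l * r l, Q i * r i) / 2
      ≤ ∑ i with ¬ r i ≤ c * ∑ l, Q l * r l, Q i * r i * (if η * r i ≤ |x i| then 1 else 0)) :
    (1 / 2 - 4 * ε) * (∑ i, Q i * r i) ^ 2
      ≤ ∑ i, Q i * klFun (1 + x i) - klFun (1 + ∑ i, Q i * x i) := by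
  set R := ∑ i, Q i * r i with hRdef
  set I := Finset.univ.filter fun i => r i ≤ c * R with hI
  set J := Finset.univ.filter fun i => ¬ r i ≤ c * R with hJ
  set b := ∑ i ∈ J, Q i * r i with hbdef
  have hsplit : ∀ f : ι → ℝ, ∑ i, f i = ∑ i ∈ I, f i + ∑ i ∈ J, f i := fun f =>
    (Finset.sum_filter_add_sum_filter_not _ _ _).symm
  have hb0 : 0 ≤ b := Finset.sum_nonneg fun i _ => mul_nonneg (hQ i) (hr i)
  have hIR : ∑ i ∈ I, Q i * r i = R - b := by rw [hRdef, hsplit]; ring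
  have hbR : b ≤ R := by
    have : 0 ≤ ∑ i ∈ I, Q i * r i := Finset.sum_nonneg fun i _ => mul_nonneg (hQ i) (hr i)
    linarith
  have hcpos : 0 < c := by
    have h0 : 0 < 4 * (2 + ε) * (K + 1 / ε) := by positivity
    exact pos_of_mul_pos_left (h0.trans_le hc) (sq_nonneg η)
  -- the total variance
  have hV : K * ∑ i, Q i ^ 2 * r i ^ 2 ≤ ε * R ^ 2 + K * b ^ 2 := by
    rw [hsplit, mul_add]
    have e1 : ∑ i ∈ I, Q i ^ 2 * r i ^ 2 ≤ c ^ 2 * R ^ 2 * ∑ i, Q i ^ 2 := by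
      rw [Finset.mul_sum]
      calc ∑ i ∈ I, Q i ^ 2 * r i ^ 2 ≤ ∑ i ∈ I, c ^ 2 * R ^ 2 * Q i ^ 2 := by
            refine Finset.sum_le_sum fun i hi => ?_
            have := pow_le_pow_left₀ (hr i) (Finset.mem_filter.mp hi).2 2
            nlinarith [sq_nonneg (Q i)]
        _ ≤ _ := Finset.sum_le_sum_of_subset_of_nonneg (Finset.filter_subset _ _)
            fun i _ _ => by positivity
    have e2 : ∑ i ∈ J, Q i ^ 2 * r i ^ 2 ≤ b ^ 2 := by
      have := Finset.sum_sq_le_sq_sum_of_nonneg (s := J) (f := fun i => Q i * r i)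
        fun i _ => mul_nonneg (hQ i) (hr i)
      simpa only [mul_pow] using this
    have e3 := mul_le_mul_of_nonneg_left e1 hK.le
    have e4 := mul_le_mul_of_nonneg_left e2 hK.le
    have e5 := mul_le_mul_of_nonneg_right hs (sq_nonneg R)
    nlinarith
  -- the branches of moderate deviation
  have hM : (R - b) ^ 2 ≤ ∑ i ∈ I, Q i * r i ^ 2 := by
    have hcs := Finset.sum_sq_le_sum_mul_sum_of_sq_le_mul I (r := fun i => Q i * r i)
      (f := fun i => Q i) (g := fun i => Q i * r i ^ 2) (fun i _ => hQ i)
      (fun i _ => mul_nonneg (hQ i) (sq_nonneg _)) (fun i _ => le_of_eq (by ring))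
    rw [hIR] at hcs
    have hQI : ∑ i ∈ I, Q i ≤ 1 := hQ1 ▸ Finset.sum_le_sum_of_subset_of_nonneg
      (Finset.filter_subset _ _) fun i _ _ => hQ i
    have : 0 ≤ ∑ i ∈ I, Q i * r i ^ 2 :=
      Finset.sum_nonneg fun i _ => mul_nonneg (hQ i) (sq_nonneg _)
    nlinarith
  have hkI : ((1 - ε) * (R - b) ^ 2 - ε * R ^ 2) / (2 + ε) ≤ ∑ i ∈ I, Q i * klFun (1 + x i) := by
    calc _ ≤ (∑ i ∈ I, Q i * r i ^ 2 * G i) / (2 + ε) := by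
          refine div_le_div_of_nonneg_right ?_ (by linarith)
          nlinarith
      _ = ∑ i ∈ I, Q i * (r i ^ 2 * G i / (2 + ε)) := by
          rw [Finset.sum_div]
          exact Finset.sum_congr rfl fun i _ => by ring
      _ ≤ _ := Finset.sum_le_sum fun i _ => mul_le_mul_of_nonneg_left
          (div_le_klFun_one_add (hx i) hε.le (hGx i) (hGε i)) (hQ i)
  -- the branches of large deviation
  have hQJ : c * ∑ i ∈ J, Q i ≤ 1 := by
    have : c * R * ∑ i ∈ J, Q i ≤ b := by
      rw [Finset.mul_sum]
      refine Finset.sum_le_sum fun i hi => ?_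
      have := (not_le.mp (Finset.mem_filter.mp hi).2).le
      nlinarith [hQ i]
    by_contra h
    nlinarith
  set z : ι → ℝ := fun i => if η * r i ≤ |x i| then 1 else 0 with hz
  have hz2 : ∀ i, z i ^ 2 = z i := fun i => by simp only [hz]; split_ifs <;> norm_num
  have hz0 : ∀ i, 0 ≤ z i := fun i => by simp only [hz]; split_ifs <;> norm_num
  -- At least half of the share `b` comes from branches with `|x i| ≥ η r i`; Cauchy-Schwarz against
  -- a `Q`-mass of at most `1 / c` gains the factor `c`.
  have hN : c * (b / 2) ^ 2 ≤ ∑ i ∈ J, Q i * r i ^ 2 * z i := by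
    have hcs := Finset.sum_sq_le_sum_mul_sum_of_sq_le_mul J (r := fun i => Q i * r i * z i)
      (f := fun i => Q i) (g := fun i => Q i * r i ^ 2 * z i) (fun i _ => hQ i)
      (fun i _ => mul_nonneg (mul_nonneg (hQ i) (sq_nonneg _)) (hz0 i))
      (fun i _ => le_of_eq (by linear_combination (Q i * r i) ^ 2 * hz2 i))
    have hsq : (b / 2) ^ 2 ≤ (∑ i ∈ J, Q i * r i * z i) ^ 2 :=
      pow_le_pow_left₀ (by positivity) h3 2
    have hnn : 0 ≤ ∑ i ∈ J, Q i * r i ^ 2 * z i :=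
      Finset.sum_nonneg fun i _ => mul_nonneg (mul_nonneg (hQ i) (sq_nonneg _)) (hz0 i)
    calc c * (b / 2) ^ 2 ≤ c * ((∑ i ∈ J, Q i) * ∑ i ∈ J, Q i * r i ^ 2 * z i) :=
          mul_le_mul_of_nonneg_left (hsq.trans hcs) hcpos.le
      _ = (c * ∑ i ∈ J, Q i) * ∑ i ∈ J, Q i * r i ^ 2 * z i := by ring
      _ ≤ 1 * ∑ i ∈ J, Q i * r i ^ 2 * z i := mul_le_mul_of_nonneg_right hQJ hnn
      _ = _ := one_mul _
  -- The part `K b²` cancels the contribution of these branches to `klFun (1 + ∑ Q i x i)`, and `b²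
  -- / ε` feeds `sq_mul_le_of_share`.
  have hkJ : (K + 1 / ε) * b ^ 2 ≤ ∑ i ∈ J, Q i * klFun (1 + x i) := by
    calc (K + 1 / ε) * b ^ 2 ≤ η ^ 2 * (c * (b / 2) ^ 2) / (2 + ε) := by
          rw [le_div_iff₀ (by linarith)]
          nlinarith [mul_le_mul_of_nonneg_right hc (sq_nonneg b)]
      _ ≤ η ^ 2 * (∑ i ∈ J, Q i * r i ^ 2 * z i) / (2 + ε) := by gcongr
      _ = ∑ i ∈ J, Q i * (η ^ 2 * r i ^ 2 * z i / (2 + ε)) := by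
          rw [Finset.mul_sum, Finset.sum_div]
          exact Finset.sum_congr rfl fun i _ => by ring
      _ ≤ _ := by
          refine Finset.sum_le_sum fun i _ => mul_le_mul_of_nonneg_left
            (div_le_klFun_one_add (hx i) hε.le ?_ ?_) (hQ i)
          · by_cases h : η * r i ≤ |x i|
            · simp only [hz, if_pos h, mul_one, ← mul_pow, ← sq_abs (x i)]
              exact pow_le_pow_left₀ (mul_nonneg hη.le (hr i)) h 2
            · simp only [hz, if_neg h, mul_zero]
              exact sq_nonneg _
          · have : η ^ 2 * r i ^ 2 ≤ ε ^ 2 := by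
              rw [← mul_pow, mul_comm]
              exact pow_le_pow_left₀ (mul_nonneg (hr i) hη.le) (hηε i) 2
            by_cases h : η * r i ≤ |x i|
            · simpa only [hz, if_pos h, mul_one] using this
            · simp only [hz, if_neg h, mul_zero]
              exact sq_nonneg _
  have hkb := klFun_one_add_le_sq hb1
  have hfin := sq_mul_le_of_share hε hε1 hR.le hb0
  rw [hsplit fun i => Q i * klFun (1 + x i)]
  linarith

/-! ### Typical outcomes have high probability -/

/-- **Chebyshev's inequality** for sums of pairwise independent variables. -/
theorem measureReal_lt_sq_sum_sub_le {Ω ι : Type*} [MeasurableSpace Ω] {μ : Measure Ω}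
    [IsProbabilityMeasure μ] {X : ι → Ω → ℝ} {s : Finset ι} (hX : ∀ i, MemLp (X i) 2 μ)
    (hind : Pairwise fun i j => IndepFun (X i) (X j) μ) {v θ : ℝ} (hv : 0 < v)
    (hV : ∑ i ∈ s, Var[X i; μ] ≤ θ * v) :
    μ.real {ω | v < (∑ i ∈ s, X i ω - ∑ i ∈ s, μ[X i]) ^ 2} ≤ θ := by
  have hsum : MemLp (∑ i ∈ s, X i) 2 μ := by
    have := memLp_finsetSum s (f := X) fun i _ => hX i
    simpa only [← Finset.sum_apply] using this
  have hmean : μ[∑ i ∈ s, X i] = ∑ i ∈ s, μ[X i] := by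
    simp only [Finset.sum_apply]
    exact integral_finsetSum _ fun i _ => (hX i).integrable (by norm_num)
  have hvar := IndepFun.variance_sum (s := s) (fun i _ => hX i) (hind.set_pairwise _)
  have hc := meas_ge_le_variance_div_sq hsum (Real.sqrt_pos.mpr hv)
  rw [hmean, hvar, Real.sq_sqrt hv.le] at hc
  have hθ : (∑ i ∈ s, Var[X i; μ]) / v ≤ θ := (div_le_iff₀ hv).mpr hV
  have hθ0 : 0 ≤ (∑ i ∈ s, Var[X i; μ]) / v :=
    div_nonneg (Finset.sum_nonneg fun i _ => variance_nonneg _ _) hv.le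
  refine le_trans (ENNReal.toReal_le_of_le_ofReal hθ0 (le_trans (measure_mono fun ω hω => ?_) hc)) hθ
  simp only [Set.mem_ofPred_eq, Finset.sum_apply] at hω ⊢
  exact (Real.sqrt_le_sqrt hω.le).trans (Real.sqrt_sq_eq_abs _).le

/-- A weighted sum of indicators of unlikely events rarely exceeds half of its maximal value. -/
theorem measureReal_half_sum_lt_sum_indicator_le {Ω ι : Type*} [MeasurableSpace Ω] {μ : Measure Ω}
    [IsProbabilityMeasure μ] {s : Finset ι} {a : ι → ℝ} (ha : ∀ i, 0 ≤ a i) {E : ι → Set Ω}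
    (hE : ∀ i, NullMeasurableSet (E i) μ) {θ : ℝ} (hθ0 : 0 ≤ θ) (hθ : ∀ i, μ.real (E i) ≤ θ / 2) :
    μ.real {ω | (∑ i ∈ s, a i) / 2 < ∑ i ∈ s, a i * (E i).indicator (fun _ => (1 : ℝ)) ω} ≤ θ := by
  have hz : ∀ i ω, 0 ≤ (E i).indicator (fun _ => (1 : ℝ)) ω := fun i ω =>
    Set.indicator_nonneg (fun _ _ => zero_le_one) _
  have hz1 : ∀ i ω, (E i).indicator (fun _ => (1 : ℝ)) ω ≤ 1 := fun i ω =>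
    Set.indicator_le_self' (fun _ _ => zero_le_one) _
  have hint : ∀ i, Integrable ((E i).indicator fun _ => (1 : ℝ)) μ := fun i =>
    (integrable_const (1 : ℝ)).indicator₀ (hE i)
  rcases (Finset.sum_nonneg fun i (_ : i ∈ s) => ha i).eq_or_lt with h0 | hpos
  · have : {ω | (∑ i ∈ s, a i) / 2 < ∑ i ∈ s, a i * (E i).indicator (fun _ => (1 : ℝ)) ω} = ∅ := by
      ext ω
      simp only [Set.mem_ofPred_eq, Set.mem_empty_iff_false, iff_false, not_lt]
      have : ∑ i ∈ s, a i * (E i).indicator (fun _ => (1 : ℝ)) ω ≤ ∑ i ∈ s, a i :=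
        Finset.sum_le_sum fun i _ => mul_le_of_le_one_right (ha i) (hz1 i ω)
      linarith
    rw [this, measureReal_empty]
    exact hθ0
  · have hm := mul_meas_ge_le_integral_of_nonneg (μ := μ)
      (f := fun ω => ∑ i ∈ s, a i * (E i).indicator (fun _ => (1 : ℝ)) ω)
      (ae_of_all _ fun ω => Finset.sum_nonneg fun i _ => mul_nonneg (ha i) (hz i ω))
      (integrable_finsetSum _ fun i _ => (hint i).const_mul _) ((∑ i ∈ s, a i) / 2)
    have hI : ∫ ω, ∑ i ∈ s, a i * (E i).indicator (fun _ => (1 : ℝ)) ω ∂μ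
        ≤ (∑ i ∈ s, a i) * (θ / 2) := by
      rw [integral_finsetSum _ fun i _ => (hint i).const_mul _, Finset.sum_mul]
      refine Finset.sum_le_sum fun i _ => ?_
      rw [integral_const_mul, integral_indicator₀ (hE i)]
      simpa using mul_le_mul_of_nonneg_left (hθ i) (ha i)
    have hle : μ.real {ω | (∑ i ∈ s, a i) / 2
        < ∑ i ∈ s, a i * (E i).indicator (fun _ => (1 : ℝ)) ω} ≤ μ.real {ω | (∑ i ∈ s, a i) / 2
        ≤ ∑ i ∈ s, a i * (E i).indicator (fun _ => (1 : ℝ)) ω} :=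
      measureReal_mono fun ω hω => (Set.mem_ofPred.mp hω).le
    refine le_of_mul_le_mul_left ?_ (half_pos hpos)
    calc _ ≤ _ := mul_le_mul_of_nonneg_left hle (half_pos hpos).le
      _ ≤ _ := hm.trans hI
      _ = _ := by ring

/-- For independent deviations `X_i` of small variances `r_i²` that are close to normal
distributions, and weights `Q_i` none of which dominates, the numerator of the divergence is at
least about half the square of the mean of the `r_i`. -/
theorem exists_le_measureReal_sum_mul_klFun {ε θ : ℝ} (hε : 0 < ε) (hε1 : ε ≤ 1) (hθ : 0 < θ) :
    ∃ T a s ρ : ℝ, 0 < a ∧ 0 < s ∧ 0 < ρ ∧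
      ∀ {Ω : Type*} [MeasurableSpace Ω] (μ : Measure Ω) [IsProbabilityMeasure μ] {ι : Type}
        [Fintype ι] (Q r : ι → ℝ) (X : ι → Ω → ℝ), (∀ i, 0 ≤ Q i) → ∑ i, Q i = 1 →
        ∑ i, Q i ^ 2 ≤ s → (∀ i, 0 < r i) → (∀ i, r i ≤ ρ) → (∀ i, MemLp (X i) 2 μ) →
        (∀ i, μ[X i] = 0) → (∀ i, Var[X i; μ] = r i ^ 2) →
        (Pairwise fun i j => IndepFun (X i) (X j) μ) → (∀ i, ∀ᵐ ω ∂μ, -1 ≤ X i ω) →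
        (∀ i t, |t| ≤ T → ‖charFun (μ.map fun ω => X i ω / r i) t‖ ≤ Real.exp (a - t ^ 2 / 2)) →
        1 - 3 * θ ≤ μ.real {ω | |∑ i, Q i * X i ω| ≤ ε ∧ (1 / 2 - 4 * ε) * (∑ i, Q i * r i) ^ 2
          ≤ ∑ i, Q i * klFun (1 + X i ω) - klFun (1 + ∑ i, Q i * X i ω)} := by
  obtain ⟨η, hη, T, hsmall⟩ := exists_measureReal_abs_lt_le (half_pos hθ)
  obtain ⟨t, ht, a, ha, htrunc⟩ := exists_le_integral_one_sub_cos hε hε1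
  set B : ℝ := 4 / t ^ 2 with hB
  have hBpos : 0 < B := by positivity
  set K : ℝ := 1 / θ with hK
  have hKpos : 0 < K := by positivity
  set c : ℝ := 4 * (2 + ε) * (K + 1 / ε) / η ^ 2 with hc
  have hcpos : 0 < c := by positivity
  -- The summand one gives `D ≤ D²`, so `r i ≤ ε / D` bounds `r i * η` by `ε` and both `r i ^ 2 * B`
  -- and `r i ^ 2 * K` by `ε²`.
  set D : ℝ := η + B + K + 1 with hD
  have hDpos : 0 < D := by positivity
  -- The first bound on `∑ Q i ^ 2` limits the variance of the mean deviation below the threshold;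
  -- the second is what Chebyshev needs for the truncated squares.
  refine ⟨max T t, min a 1, min (ε / (K * c ^ 2)) (θ * ε ^ 2 / (c ^ 4 * B ^ 2)), ε / D,
    lt_min ha one_pos, by positivity, by positivity, ?_⟩
  intro Ω _ μ _ ι _ Q r X hQ hQ1 hs hr hρ hX hmean hvar hind hX1 hch
  have hs1 : K * c ^ 2 * ∑ i, Q i ^ 2 ≤ ε := by
    have := hs.trans (min_le_left _ _)
    rw [le_div_iff₀ (by positivity)] at this
    linarith
  have hs2 : c ^ 4 * B ^ 2 * ∑ i, Q i ^ 2 ≤ θ * ε ^ 2 := by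
    have := hs.trans (min_le_right _ _)
    rw [le_div_iff₀ (by positivity)] at this
    linarith
  have hrD : ∀ i, r i * D ≤ ε := fun i => (le_div_iff₀ hDpos).mp (hρ i)
  have hrη : ∀ i, r i * η ≤ ε := fun i =>
    (mul_le_mul_of_nonneg_left (by rw [hD]; linarith) (hr i).le).trans (hrD i)
  have hrsq : ∀ i, r i ^ 2 * D ^ 2 ≤ ε ^ 2 := fun i => by
    rw [← mul_pow]
    exact pow_le_pow_left₀ (mul_nonneg (hr i).le hDpos.le) (hrD i) 2
  have hrB : ∀ i, r i ^ 2 * B ≤ ε ^ 2 := fun i =>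
    (mul_le_mul_of_nonneg_left (by rw [hD]; nlinarith) (sq_nonneg (r i))).trans (hrsq i)
  have hrK : ∀ i, r i ^ 2 * K ≤ ε ^ 2 := fun i =>
    (mul_le_mul_of_nonneg_left (by rw [hD]; nlinarith) (sq_nonneg (r i))).trans (hrsq i)
  obtain ⟨i₀, hi₀⟩ : ∃ i, 0 < Q i := by
    by_contra! h
    have := Finset.sum_nonpos fun i (_ : i ∈ Finset.univ) => h i
    linarith
  set R := ∑ i, Q i * r i with hR
  have hRpos : 0 < R := Finset.sum_pos' (fun i _ => mul_nonneg (hQ i) (hr i).le)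
    ⟨i₀, Finset.mem_univ _, mul_pos hi₀ (hr i₀)⟩
  set V := ∑ i, Q i ^ 2 * r i ^ 2 with hV
  have hVpos : 0 < V := Finset.sum_pos' (fun i _ => by positivity)
    ⟨i₀, Finset.mem_univ _, mul_pos (pow_pos hi₀ 2) (pow_pos (hr i₀) 2)⟩
  have hKV : K * V ≤ ε ^ 2 := by
    have hQ2 : ∑ i, Q i ^ 2 ≤ 1 := by
      have := Finset.sum_sq_le_sq_sum_of_nonneg (s := Finset.univ) (f := Q) fun i _ => hQ i
      rwa [hQ1, one_pow] at this
    calc K * V = ∑ i, Q i ^ 2 * (r i ^ 2 * K) := by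
          rw [hV, Finset.mul_sum]
          exact Finset.sum_congr rfl fun i _ => by ring
      _ ≤ ∑ i, Q i ^ 2 * ε ^ 2 := Finset.sum_le_sum fun i _ =>
          mul_le_mul_of_nonneg_left (hrK i) (sq_nonneg _)
      _ ≤ ε ^ 2 := by
          rw [← Finset.sum_mul]
          exact mul_le_of_le_one_left (sq_nonneg ε) hQ2
  -- truncated squares of the normalized deviations
  set φ : ℝ → ℝ := fun x => 2 * (1 - Real.cos (t * x)) / t ^ 2 with hφ
  have hφm : Measurable φ := by fun_prop
  have hφ0 : ∀ x, 0 ≤ φ x := fun x =>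
    div_nonneg (by linarith [Real.cos_le_one (t * x)]) (sq_nonneg t)
  have hφB : ∀ x, φ x ≤ B := fun x =>
    div_le_div_of_nonneg_right (by linarith [Real.neg_one_le_cos (t * x)]) (sq_nonneg t)
  have hφsq : ∀ x, φ x ≤ x ^ 2 := fun x => by
    simp only [hφ]
    rw [div_le_iff₀ (by positivity)]
    have := Real.one_sub_sq_div_two_le_cos (x := t * x)
    nlinarith
  set G : ι → Ω → ℝ := fun i ω => φ (X i ω / r i) with hG
  have hXm : ∀ i, AEMeasurable (X i) μ := fun i => (hX i).1.aemeasurable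
  have hprob : ∀ i, IsProbabilityMeasure (μ.map fun ω => X i ω / r i) := fun i =>
    Measure.isProbabilityMeasure_map ((hXm i).div_const _)
  have hGm : ∀ i, AEMeasurable (G i) μ := fun i => hφm.comp_aemeasurable ((hXm i).div_const _)
  have hGmean : ∀ i, 1 - ε ≤ ∫ ω, G i ω ∂μ := fun i => by
    have := htrunc (μ.map fun ω => X i ω / r i) (hprob i)
      ((hch i t (by rw [abs_of_pos ht]; exact le_max_right _ _)).trans
        (Real.exp_le_exp.mpr (by linarith [min_le_left a 1])))
    rwa [integral_map ((hXm i).div_const _) (by fun_prop)] at this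
  have hGx : ∀ i ω, r i ^ 2 * G i ω ≤ X i ω ^ 2 := fun i ω => by
    have h1 := mul_le_mul_of_nonneg_left (hφsq (X i ω / r i)) (sq_nonneg (r i))
    rwa [← mul_pow, mul_div_cancel₀ _ (hr i).ne'] at h1
  have hGε : ∀ i ω, r i ^ 2 * G i ω ≤ ε ^ 2 := fun i ω =>
    (mul_le_mul_of_nonneg_left (hφB _) (sq_nonneg _)).trans (hrB i)
  set I := Finset.univ.filter fun i => r i ≤ c * R with hI
  set J := Finset.univ.filter fun i => ¬ r i ≤ c * R with hJ
  set E : ι → Set Ω := fun i => {ω | |X i ω| < η * r i} with hE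
  -- The exceptional events: a large mean deviation, truncated squares far from their mean, and too
  -- many nearly vanishing deviations above the threshold. Each has probability at most `θ`.
  set bad1 := {ω | K * V < (∑ i, Q i * X i ω) ^ 2} with hbad1
  set bad2 := {ω | (ε * R ^ 2) ^ 2 < (∑ i ∈ I, Q i * r i ^ 2 * G i ω
    - ∑ i ∈ I, ∫ ω, Q i * r i ^ 2 * G i ω ∂μ) ^ 2} with hbad2
  set bad3 := {ω | (∑ i ∈ J, Q i * r i) / 2
    < ∑ i ∈ J, Q i * r i * (E i).indicator (fun _ => (1 : ℝ)) ω} with hbad3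
  have hb1 : μ.real bad1 ≤ θ := by
    have := measureReal_lt_sq_sum_sub_le (μ := μ) (s := Finset.univ) (v := K * V) (θ := θ)
      (X := fun i ω => Q i * X i ω) (fun i => (hX i).const_mul _)
      (fun i j hij => (hind hij).comp (φ := fun x => Q i * x) (ψ := fun x => Q j * x)
        (by fun_prop) (by fun_prop)) (by positivity)
      (by
        rw [hK, ← mul_assoc, mul_one_div_cancel hθ.ne', one_mul, hV]
        exact Finset.sum_le_sum fun i _ => by rw [variance_const_mul, hvar])
    simpa only [integral_const_mul, hmean, mul_zero, Finset.sum_const_zero, sub_zero] using this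
  have hb2 : μ.real bad2 ≤ θ := by
    have hGb : ∀ i, ∀ᵐ ω ∂μ, G i ω ∈ Set.Icc 0 B := fun i => ae_of_all _ fun ω => ⟨hφ0 _, hφB _⟩
    refine measureReal_lt_sq_sum_sub_le (μ := μ) (X := fun i ω => Q i * r i ^ 2 * G i ω)
      (fun i => (memLp_of_bounded (hGb i) (hGm i).aestronglyMeasurable 2).const_mul _)
      (fun i j hij => (hind hij).comp (φ := fun x => Q i * r i ^ 2 * φ (x / r i))
        (ψ := fun x => Q j * r j ^ 2 * φ (x / r j))
        (by fun_prop) (by fun_prop)) (by positivity) ?_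
    calc ∑ i ∈ I, Var[fun ω => Q i * r i ^ 2 * G i ω; μ]
        ≤ ∑ i ∈ I, c ^ 4 * R ^ 4 * B ^ 2 * Q i ^ 2 := by
          refine Finset.sum_le_sum fun i hi => ?_
          rw [variance_const_mul]
          have h1 := variance_le_sq_of_bounded (hGb i) (hGm i)
          have h2 : r i ^ 4 ≤ c ^ 4 * R ^ 4 := by
            rw [← mul_pow]
            exact pow_le_pow_left₀ (hr i).le (Finset.mem_filter.mp hi).2 4
          have h3 : Var[G i; μ] ≤ B ^ 2 := h1.trans (by nlinarith)
          calc (Q i * r i ^ 2) ^ 2 * Var[G i; μ] ≤ (Q i * r i ^ 2) ^ 2 * B ^ 2 := by gcongr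
            _ = r i ^ 4 * (B ^ 2 * Q i ^ 2) := by ring
            _ ≤ c ^ 4 * R ^ 4 * (B ^ 2 * Q i ^ 2) := by gcongr
            _ = _ := by ring
      _ ≤ ∑ i, c ^ 4 * R ^ 4 * B ^ 2 * Q i ^ 2 := Finset.sum_le_sum_of_subset_of_nonneg
          (Finset.filter_subset _ _) fun i _ _ => by positivity
      _ = R ^ 4 * (c ^ 4 * B ^ 2 * ∑ i, Q i ^ 2) := by
          rw [← Finset.mul_sum]
          ring
      _ ≤ R ^ 4 * (θ * ε ^ 2) := by gcongr
      _ = θ * (ε * R ^ 2) ^ 2 := by ring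
  have hb3 : μ.real bad3 ≤ θ := by
    refine measureReal_half_sum_lt_sum_indicator_le (fun i => mul_nonneg (hQ i) (hr i).le)
      (fun i => nullMeasurableSet_lt (hXm i).abs aemeasurable_const) hθ.le fun i => ?_
    have := hsmall (μ.map fun ω => X i ω / r i) (hprob i) fun t' ht' =>
      (hch i t' (ht'.trans (le_max_left _ _))).trans
        (Real.exp_le_exp.mpr (by linarith [min_le_right a 1]))
    rw [map_measureReal_apply_of_aemeasurable ((hXm i).div_const _)
      (measurableSet_lt (by fun_prop) (by fun_prop))] at this
    refine le_trans (le_of_eq ?_) this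
    congr 1
    ext ω
    simp only [Set.mem_ofPred_eq, Set.mem_preimage, abs_div, abs_of_pos (hr i), div_lt_iff₀ (hr i)]
  set bad4 := {ω | ¬ ∀ i, -1 ≤ X i ω} with hbad4
  have hb4 : μ.real bad4 = 0 := by
    rw [Measure.real, (ae_iff.mp (ae_all_iff.mpr hX1)), ENNReal.toReal_zero]
  have hcover : Set.univ ⊆ {ω | |∑ i, Q i * X i ω| ≤ ε ∧ (1 / 2 - 4 * ε) * R ^ 2
      ≤ ∑ i, Q i * klFun (1 + X i ω) - klFun (1 + ∑ i, Q i * X i ω)}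
      ∪ (bad1 ∪ (bad2 ∪ (bad3 ∪ bad4))) := by
    intro ω _
    by_contra hω
    simp only [Set.mem_union, not_or] at hω
    obtain ⟨hgood, h1, h2, h3, h4⟩ := hω
    simp only [hbad1, hbad2, hbad3, hbad4, Set.mem_ofPred_eq, not_lt, not_not] at h1 h2 h3 h4
    refine hgood ⟨abs_le_of_sq_le_sq (h1.trans hKV) hε.le, ?_⟩
    refine le_sum_mul_klFun_sub Q r (fun i => X i ω) (fun i => G i ω) (K := K) (c := c) (η := η)
      hQ hQ1 (fun i => (hr i).le) hRpos hKpos hη hε hε1 ?_ hs1 h4 (fun i => hGx i ω)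
      (fun i => hGε i ω) hrη ?_ h1 ?_ ?_
    · rw [hc, div_mul_cancel₀ _ (by positivity)]
    · have := Finset.sum_le_sum fun i (_ : i ∈ Finset.univ) =>
        mul_le_mul_of_nonneg_left (h4 i) (hQ i)
      rw [← Finset.sum_mul, hQ1] at this
      linarith
    · have hle := (abs_le.mp (abs_le_of_sq_le_sq h2 (by positivity))).1
      have hm : (1 - ε) * ∑ i ∈ I, Q i * r i ^ 2
          ≤ ∑ i ∈ I, ∫ ω, Q i * r i ^ 2 * G i ω ∂μ := by
        rw [Finset.mul_sum]
        refine Finset.sum_le_sum fun i _ => ?_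
        rw [integral_const_mul, mul_comm]
        exact mul_le_mul_of_nonneg_left (hGmean i) (mul_nonneg (hQ i) (sq_nonneg _))
      linarith
    · have he : ∑ i ∈ J, Q i * r i = ∑ i ∈ J, Q i * r i * (if η * r i ≤ |X i ω| then 1 else 0)
          + ∑ i ∈ J, Q i * r i * (E i).indicator (fun _ => (1 : ℝ)) ω := by
        rw [← Finset.sum_add_distrib]
        refine Finset.sum_congr rfl fun i _ => ?_
        by_cases h : η * r i ≤ |X i ω|
        · rw [if_pos h, Set.indicator_of_notMem (by simpa only [hE, Set.mem_ofPred_eq, not_lt])]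
          ring
        · rw [if_neg h, Set.indicator_of_mem (by simpa only [hE, Set.mem_ofPred_eq, not_le] using h)]
          ring
      linarith
  have htot := (measureReal_mono (μ := μ) hcover).trans (measureReal_union_le _ _)
  have h1 := measureReal_union_le (μ := μ) bad1 (bad2 ∪ (bad3 ∪ bad4))
  have h2 := measureReal_union_le (μ := μ) bad2 (bad3 ∪ bad4)
  have h3 := measureReal_union_le (μ := μ) bad3 bad4
  rw [probReal_univ] at htot
  linarith

/-! ### Moments and characteristic functions of weighted Bernoulli sums -/

section Bernoulli

variable {Ω : Type*} [MeasurableSpace Ω] {μ : Measure Ω} {v : ℝ} {p : unitInterval} {S : Ω → ℝ}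

theorem ae_mem_Icc_of_hasLaw_bernoulliMeasure (hv : 0 ≤ v)
    (hS : HasLaw S (bernoulliMeasure v 0 p) μ) : ∀ᵐ ω ∂μ, S ω ∈ Set.Icc 0 v := by
  rw [hS.ae_iff (p := fun x => x ∈ Set.Icc 0 v) measurableSet_Icc.mem, ae_iff]
  refine bernoulliMeasure_apply_of_notMem_of_notMem p (measurableSet_Icc.compl) ?_ ?_
  all_goals simp [hv]

theorem integral_of_hasLaw_bernoulliMeasure (hS : HasLaw S (bernoulliMeasure v 0 p) μ) :
    μ[S] = p * v := by
  rw [hS.integral_eq, integral_bernoulliMeasure]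
  simp

theorem variance_of_hasLaw_bernoulliMeasure (hS : HasLaw S (bernoulliMeasure v 0 p) μ) :
    Var[S; μ] = v ^ 2 * p * (1 - p) := by
  rw [hS.variance_eq, variance_eq_integral aemeasurable_id, integral_bernoulliMeasure,
    integral_bernoulliMeasure]
  simp only [id, smul_eq_mul]
  ring

end Bernoulli

section Branch

variable {Ω : Type*} [MeasurableSpace Ω] {μ : Measure Ω} {n : ℕ}
  {v : Fin n → ℝ} {p : unitInterval} {S : Fin n → Ω → ℝ}

theorem memLp_of_hasLaw_bernoulliMeasure [IsProbabilityMeasure μ] (hv : ∀ j, 0 ≤ v j)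
    (hS : ∀ j, HasLaw (S j) (bernoulliMeasure (v j) 0 p) μ) (j : Fin n) : MemLp (S j) 2 μ :=
  memLp_of_bounded (ae_mem_Icc_of_hasLaw_bernoulliMeasure (hv j) (hS j))
    (hS j).aemeasurable.aestronglyMeasurable 2

theorem integral_sum_of_hasLaw_bernoulliMeasure [IsProbabilityMeasure μ] (hv : ∀ j, 0 ≤ v j)
    (hS : ∀ j, HasLaw (S j) (bernoulliMeasure (v j) 0 p) μ) :
    ∫ ω, ∑ j, S j ω ∂μ = p * ∑ j, v j := by
  rw [integral_finsetSum _ fun j _ =>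
    (memLp_of_hasLaw_bernoulliMeasure hv hS j).integrable (by norm_num), Finset.mul_sum]
  exact Finset.sum_congr rfl fun j _ => integral_of_hasLaw_bernoulliMeasure (hS j)

theorem variance_sum_of_hasLaw_bernoulliMeasure [IsProbabilityMeasure μ] (hv : ∀ j, 0 ≤ v j)
    (hS : ∀ j, HasLaw (S j) (bernoulliMeasure (v j) 0 p) μ) (hind : iIndepFun S μ) :
    Var[fun ω => ∑ j, S j ω; μ] = ∑ j, v j ^ 2 * p * (1 - p) := by
  have := IndepFun.variance_sum (s := Finset.univ)
    (fun j _ => memLp_of_hasLaw_bernoulliMeasure hv hS j)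
    (fun i _ j _ hij => hind.indepFun hij)
  rw [← Finset.sum_congr rfl fun j _ => variance_of_hasLaw_bernoulliMeasure (hS j), ← this]
  congr 1
  ext ω
  simp

/-- Independence turns the modulus into a product. Centring does not change the gap `v j / σ`
between the two values of a summand, the only quantity in the bound for one factor besides `p` and
`t`. -/
theorem norm_charFun_sum_of_hasLaw_bernoulliMeasure_le
    (hS : ∀ j, HasLaw (S j) (bernoulliMeasure (v j) 0 p) μ) (hind : iIndepFun S μ) (σ t : ℝ) :
    ‖charFun (μ.map fun ω => (∑ j, S j ω - p * ∑ j, v j) / σ) t‖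
      ≤ Real.exp (-∑ j, p * (1 - p) * (1 - Real.cos (t * (v j / σ)))) := by
  have hlaw : ∀ j, HasLaw (fun ω => (S j ω - p * v j) / σ)
      (bernoulliMeasure ((v j - p * v j) / σ) ((0 - p * v j) / σ) p) μ := fun j => by
    refine ⟨((hS j).aemeasurable.sub_const _).div_const _, ?_⟩
    rw [← map_bernoulliMeasure (v j) 0 (fun x => (x - p * v j) / σ), ← (hS j).map_eq,
      AEMeasurable.map_map_of_aemeasurable (by fun_prop) (hS j).aemeasurable]
    rfl
  have hind' : iIndepFun (fun j ω => (S j ω - p * v j) / σ) μ :=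
    hind.comp (fun j x => (x - p * v j) / σ) fun j => by fun_prop
  have hfun : (fun ω => (∑ j, S j ω - p * ∑ j, v j) / σ)
      = fun ω => ∑ j, (S j ω - p * v j) / σ := by
    ext ω
    rw [← Finset.sum_div, Finset.sum_sub_distrib, Finset.mul_sum]
  rw [hfun, hind'.charFun_map_fun_sum_eq_prod fun j => (hlaw j).aemeasurable, Finset.prod_apply,
    norm_prod, ← Finset.sum_neg_distrib, Real.exp_sum]
  refine Finset.prod_le_prod (fun j _ => norm_nonneg _) fun j _ => ?_
  rw [(hlaw j).map_eq]
  refine (norm_charFun_bernoulliMeasure_le _ _ p t).trans (le_of_eq ?_)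
  ring_nf

end Branch

theorem iIndepFun.indepFun_sum_sum {Ω : Type*} [MeasurableSpace Ω] {μ : Measure Ω} {k n : ℕ}
    {S : Fin k → Fin n → Ω → ℝ}
    (hm : ∀ i j, AEMeasurable (S i j) μ)
    (hind : iIndepFun (fun ij : Fin k × Fin n => S ij.1 ij.2) μ) {i i' : Fin k} (hi : i ≠ i') :
    IndepFun (fun ω => ∑ j, S i j ω) (fun ω => ∑ j, S i' j ω) μ := by
  set s : Fin k → Finset (Fin k × Fin n) := fun i => Finset.univ.image fun j => (i, j) with hs
  have hmem : ∀ i j, (i, j) ∈ s i := fun i j => Finset.mem_image_of_mem _ (Finset.mem_univ j)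
  have hdisj : Disjoint (s i) (s i') := by
    rw [Finset.disjoint_left]
    intro x hx hx'
    obtain ⟨j, -, rfl⟩ := Finset.mem_image.mp hx
    obtain ⟨j', -, h⟩ := Finset.mem_image.mp hx'
    exact hi (Prod.ext_iff.mp h).1.symm
  exact (hind.indepFun_finset₀ (s i) (s i') hdisj fun ij => hm ij.1 ij.2).comp
    (φ := fun f => ∑ j, f ⟨(i, j), hmem i j⟩) (ψ := fun f => ∑ j, f ⟨(i', j), hmem i' j⟩)
    (by fun_prop) (by fun_prop)


/-- Lyapunov's quotient controls the moments of the summands, normalized by the standard deviation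
of the sum. -/
theorem mul_sum_div_rpow_le_lyapunovRatio {n : ℕ} {δ p q₀ : ℝ} {v : Fin n → ℝ} (hδ : 0 < δ)
    (hp : 0 < p) (hq₀ : 0 < q₀) (hp1 : q₀ ≤ 1 - p) (hv : ∀ j, 0 ≤ v j)
    (hσ : 0 < ∑ j, v j ^ 2 * p * (1 - p)) :
    p * (1 - p) * ∑ j, (v j / √(∑ j, v j ^ 2 * p * (1 - p))) ^ (2 + 2 * δ)
      ≤ lyapunovRatio δ p v / q₀ ^ (1 + 2 * δ) := by
  set V := ∑ j, v j ^ 2 * p * (1 - p) with hV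
  have hq : 0 < 1 - p := hq₀.trans_le hp1
  have hpow : √V ^ (2 + 2 * δ) = V ^ (1 + δ) := by
    rw [show 2 + 2 * δ = 2 * (1 + δ) by ring, Real.rpow_mul (Real.sqrt_nonneg _), Real.rpow_two,
      Real.sq_sqrt hσ.le]
  have hsum : ∑ j, (v j / √V) ^ (2 + 2 * δ) = (∑ j, v j ^ (2 + 2 * δ)) / V ^ (1 + δ) := by
    rw [Finset.sum_div]
    exact Finset.sum_congr rfl fun j _ => by
      rw [Real.div_rpow (hv j) (Real.sqrt_nonneg _), hpow]
  have hm : 0 ≤ ∑ j, v j ^ (2 + 2 * δ) := Finset.sum_nonneg fun j _ => Real.rpow_nonneg (hv j) _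
  -- Only the first summand of the numerator is used; the second is dropped as nonnegative.
  have hcoef : q₀ ^ (1 + 2 * δ) * (p * (1 - p))
      ≤ p * (1 - p) ^ (2 + 2 * δ) + p ^ (2 + 2 * δ) * (1 - p) := by
    have h1 : (1 - p) ^ (2 + 2 * δ) = (1 - p) ^ (1 + 2 * δ) * (1 - p) := by
      rw [show 2 + 2 * δ = (1 + 2 * δ) + 1 by ring, Real.rpow_add_one hq.ne']
    have h2 : q₀ ^ (1 + 2 * δ) ≤ (1 - p) ^ (1 + 2 * δ) :=
      Real.rpow_le_rpow hq₀.le hp1 (by positivity)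
    have h3 : 0 ≤ p ^ (2 + 2 * δ) * (1 - p) := by positivity
    rw [h1]
    nlinarith [mul_le_mul_of_nonneg_right h2 (mul_nonneg hp.le hq.le)]
  rw [le_div_iff₀ (by positivity), hsum, lyapunovRatio, ← hV]
  calc p * (1 - p) * ((∑ j, v j ^ (2 + 2 * δ)) / V ^ (1 + δ)) * q₀ ^ (1 + 2 * δ)
      = q₀ ^ (1 + 2 * δ) * (p * (1 - p)) * ((∑ j, v j ^ (2 + 2 * δ)) / V ^ (1 + δ)) := by ring
    _ ≤ (p * (1 - p) ^ (2 + 2 * δ) + p ^ (2 + 2 * δ) * (1 - p))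
        * ((∑ j, v j ^ (2 + 2 * δ)) / V ^ (1 + δ)) :=
        mul_le_mul_of_nonneg_right hcoef (by positivity)
    _ = _ := by ring

/-! ### The Simpson root and the uniform case -/

section Simpson

variable {k n : ℕ} {w : Fin k → Fin n → ℝ}

theorem branchWeight_const (c : ℝ) (i : Fin k) :
    branchWeight (fun (_ : Fin k) (_ : Fin n) => c) i = n * c := by
  simp [branchWeight]

theorem totalWeight_pos (hk : 0 < k) (hw : ∀ i, 0 < branchWeight w i) : 0 < totalWeight w :=
  Finset.sum_pos (fun i _ => hw i) ⟨⟨0, hk⟩, Finset.mem_univ _⟩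

theorem sum_branchWeight_div (hk : 0 < k) (hw : ∀ i, 0 < branchWeight w i) :
    ∑ i, branchWeight w i / totalWeight w = 1 := by
  rw [← Finset.sum_div]
  exact div_self (totalWeight_pos hk hw).ne'

theorem card_pos_of_branchWeight_pos (i : Fin k) (hw : 0 < branchWeight w i) : 0 < n := by
  rcases Nat.eq_zero_or_pos n with rfl | h
  · simp [branchWeight] at hw
  · exact h

theorem sum_sq_pos (i : Fin k) (hw : 0 < branchWeight w i) : 0 < ∑ j, w i j ^ 2 := by
  refine (Finset.sum_nonneg fun j _ => sq_nonneg (w i j)).lt_of_ne' fun h => hw.ne' ?_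
  refine Finset.sum_eq_zero fun j _ => ?_
  have := (Finset.sum_eq_zero_iff_of_nonneg fun j _ => sq_nonneg (w i j)).mp h j (Finset.mem_univ j)
  exact pow_eq_zero_iff two_ne_zero |>.mp this

/-- This is Cauchy-Schwarz, `w_i² ≤ n ∑_j w_ij²`. -/
theorem one_div_sqrt_le_simpsonRoot (i : Fin k) (hw : 0 < branchWeight w i) :
    1 / √n ≤ simpsonRoot w i := by
  have hn : 0 < (n : ℝ) := Nat.cast_pos.mpr (card_pos_of_branchWeight_pos i hw)
  rw [simpsonRoot, one_div, ← Real.sqrt_inv]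
  refine Real.sqrt_le_sqrt ?_
  rw [← Finset.sum_div, le_div_iff₀ (pow_pos hw 2), inv_mul_le_iff₀ hn]
  simpa [branchWeight] using sq_sum_le_card_mul_sum_sq (s := Finset.univ) (f := w i)

theorem one_div_sqrt_le_meanSimpsonRoot (hk : 0 < k) (hw : ∀ i, 0 < branchWeight w i) :
    1 / √n ≤ meanSimpsonRoot w := by
  calc 1 / √n = ∑ i, branchWeight w i / totalWeight w * (1 / √n) := by
        rw [← Finset.sum_mul, sum_branchWeight_div hk hw, one_mul]
    _ ≤ _ := Finset.sum_le_sum fun i _ => mul_le_mul_of_nonneg_left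
        (one_div_sqrt_le_simpsonRoot i (hw i)) (div_nonneg (hw i).le (totalWeight_pos hk hw).le)

theorem klLowerBound_ge (hk : 0 < k) (hw : ∀ i, 0 < branchWeight w i) {p : ℝ} (hp : 0 < p) :
    klLowerBound p w ≥ 0.05 / (n * p) := by
  have hn : 0 < (n : ℝ) := Nat.cast_pos.mpr (card_pos_of_branchWeight_pos ⟨0, hk⟩ (hw _))
  have h := pow_le_pow_left₀ (by positivity) (one_div_sqrt_le_meanSimpsonRoot hk hw) 2
  rw [div_pow, one_pow, Real.sq_sqrt hn.le] at h
  rw [klLowerBound, ge_iff_le, ← div_div]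
  refine div_le_div_of_nonneg_right ?_ hp.le
  rw [div_eq_mul_one_div]
  exact mul_le_mul_of_nonneg_left h (by norm_num)

theorem klLowerBound_const (hk : 0 < k) (hn : 0 < n) (p : ℝ) {c : ℝ} (hc : 0 < c) :
    klLowerBound p (fun (_ : Fin k) (_ : Fin n) => c) = 0.05 / (n * p) := by
  have hn' : 0 < (n : ℝ) := Nat.cast_pos.mpr hn
  have hw : ∀ i, 0 < branchWeight (fun (_ : Fin k) (_ : Fin n) => c) i := fun i => by
    rw [branchWeight_const]
    positivity
  have hA : ∀ i, simpsonRoot (fun (_ : Fin k) (_ : Fin n) => c) i = √(1 / n) := fun i => by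
    rw [simpsonRoot, branchWeight_const]
    congr 1
    rw [Finset.sum_const, Finset.card_univ, Fintype.card_fin, nsmul_eq_mul]
    field_simp
  rw [klLowerBound, meanSimpsonRoot, Finset.sum_congr rfl fun i _ => by rw [hA i],
    ← Finset.sum_mul, sum_branchWeight_div hk hw, one_mul, Real.sq_sqrt (by positivity), ← div_div,
    mul_one_div]

end Simpson

/-! ### Application to the sampled branches and the limit -/

/-- The standard deviation `r_i` of `S_i / (p w_i)`. -/
theorem sqrt_mul_simpsonRoot {k n : ℕ} {w : Fin k → Fin n → ℝ} {p : ℝ} (hp : 0 < p) (hp1 : p < 1)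
    (i : Fin k) (hw : 0 < branchWeight w i) :
    √((1 - p) / p) * simpsonRoot w i
      = √(∑ j, w i j ^ 2 * p * (1 - p)) / (p * branchWeight w i) := by
  have h1 : 0 ≤ (1 - p) / p := div_nonneg (by linarith) hp.le
  have h2 : 0 < p * branchWeight w i := mul_pos hp hw
  rw [eq_div_iff h2.ne', simpsonRoot, ← Real.sqrt_mul h1]
  rw [← Real.sqrt_sq h2.le, ← Real.sqrt_mul (mul_nonneg h1 (Finset.sum_nonneg fun j _ => by positivity))]
  congr 1
  rw [← Finset.sum_div, ← Finset.sum_mul, ← Finset.sum_mul]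
  field_simp

/-- The lower bound of the divergence holds with high probability as soon as Lyapunov's quotients
and the sum of the squares of the proportions of the branches are small. -/
theorem exists_le_measureReal_klLowerBound {δ p₀ θ : ℝ} (hδ : 0 < δ) (hp₀ : p₀ < 9 / 10)
    (hθ : 0 < θ) :
    ∃ e s : ℝ, 0 < e ∧ 0 < s ∧ ∀ {Ω : Type*} [MeasurableSpace Ω] (μ : Measure Ω)
      [IsProbabilityMeasure μ] {k n : ℕ} (w : Fin k → Fin n → ℝ) (p : unitInterval)
      (S : Fin k → Fin n → Ω → ℝ), 0 < k → (∀ i j, 0 ≤ w i j) → (∀ i, 0 < branchWeight w i) →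
      0 < (p : ℝ) → (p : ℝ) ≤ p₀ → (∑ i, branchWeight w i ^ 2) / totalWeight w ^ 2 ≤ s →
      (∀ i, lyapunovRatio δ p (w i) ≤ e) →
      (∀ i j, HasLaw (S i j) (bernoulliMeasure (w i j) 0 p) μ) →
      iIndepFun (fun ij : Fin k × Fin n => S ij.1 ij.2) μ →
      1 - 3 * θ ≤ μ.real {ω | 0 < ∑ i, ∑ j, S i j ω ∧ klLowerBound p w ≤
        finiteKL (normalizeVec fun i => ∑ j, S i j ω) (normalizeVec (branchWeight w))} := by
  have hq₀ : 0 < 1 - p₀ := by linarith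
  set κ := 0.05 / (1 - p₀) with hκ
  have hκ0 : 0 < κ := by positivity
  have hκ1 : κ < 1 / 2 := by
    rw [hκ, div_lt_iff₀ hq₀]
    norm_num
    linarith
  -- Of the gap `1 / 2 - κ = 5ε`, the numerator loses `4ε`, and the factor `1 + ∑ Q i X i ≤ 1 + ε`
  -- costs at most `ε` more, because `κ < 1`.
  set ε := (1 / 2 - κ) / 5 with hε
  have hεpos : 0 < ε := by rw [hε]; linarith
  have hε1 : ε ≤ 1 / 10 := by rw [hε]; linarith
  obtain ⟨T, a, s, ρ, ha, hs, hρ, hmain⟩ :=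
    exists_le_measureReal_sum_mul_klFun hεpos (by linarith) hθ
  obtain ⟨e₁, he₁, hcos⟩ := exists_sum_one_sub_cos_ge hδ ha T
  obtain ⟨e₂, he₂, hmean⟩ := exists_le_sum_of_rpow_sum_le hδ hρ
  refine ⟨min e₁ e₂ * (1 - p₀) ^ (1 + 2 * δ), s, by positivity, hs, ?_⟩
  intro Ω _ μ _ k n w p S hk hw hwpos hp hpp₀ hspread hlyap hlaw hind
  have hq : 0 < 1 - (p : ℝ) := by linarith
  set W := totalWeight w with hW
  have hWpos : 0 < W := totalWeight_pos hk hwpos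
  set Q : Fin k → ℝ := fun i => branchWeight w i / W with hQ
  have hQpos : ∀ i, 0 < Q i := fun i => div_pos (hwpos i) hWpos
  have hQ1 : ∑ i, Q i = 1 := sum_branchWeight_div hk hwpos
  set σ : Fin k → ℝ := fun i => √(∑ j, w i j ^ 2 * p * (1 - p)) with hσ
  have hσ2 : ∀ i, 0 < ∑ j, w i j ^ 2 * (p : ℝ) * (1 - p) := fun i => by
    rw [← Finset.sum_mul, ← Finset.sum_mul]
    exact mul_pos (mul_pos (sum_sq_pos i (hwpos i)) hp) hq
  have hσpos : ∀ i, 0 < σ i := fun i => Real.sqrt_pos.mpr (hσ2 i)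
  have hpw : ∀ i, 0 < p * branchWeight w i := fun i => mul_pos hp (hwpos i)
  set r : Fin k → ℝ := fun i => σ i / (p * branchWeight w i) with hr
  have hrpos : ∀ i, 0 < r i := fun i => div_pos (hσpos i) (hpw i)
  have hRM : (∑ i, Q i * r i) ^ 2 = (1 - p) / p * meanSimpsonRoot w ^ 2 := by
    have : ∑ i, Q i * r i = √((1 - p) / p) * meanSimpsonRoot w := by
      rw [meanSimpsonRoot, Finset.mul_sum]
      refine Finset.sum_congr rfl fun i _ => ?_
      rw [mul_left_comm, sqrt_mul_simpsonRoot hp (by linarith) i (hwpos i)]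
    rw [this, mul_pow, Real.sq_sqrt (by positivity)]
  -- normalized moments
  have hb : (0 : ℝ) ≤ p * (1 - p) := by positivity
  have hu : ∀ i j, 0 ≤ w i j / σ i := fun i j => div_nonneg (hw i j) (hσpos i).le
  have hu2 : ∀ i, p * (1 - p) * ∑ j, (w i j / σ i) ^ 2 = 1 := fun i => by
    simp only [div_pow, hσ, Real.sq_sqrt (hσ2 i).le]
    rw [← Finset.sum_div, mul_div_assoc', div_eq_one_iff_eq (hσ2 i).ne', ← Finset.sum_mul,
      ← Finset.sum_mul]
    ring
  have huδ : ∀ i, p * (1 - p) * ∑ j, (w i j / σ i) ^ (2 + 2 * δ) ≤ min e₁ e₂ := fun i => by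
    refine (mul_sum_div_rpow_le_lyapunovRatio hδ hp hq₀ (by linarith) (hw i) (hσ2 i)).trans ?_
    exact (div_le_iff₀ (by positivity)).mpr (hlyap i)
  -- Small normalized moments force `p (1 - p) w_i / σ i ≥ 1 / ρ`; dropping the factor `1 - p` gives
  -- a standard deviation of at most `ρ` times the mean `p w_i`.
  have hrρ : ∀ i, r i ≤ ρ := fun i => by
    have := hmean _ _ hb (hu i) (hu2 i) ((huδ i).trans (min_le_right _ _))
    rw [← Finset.sum_div, mul_div_assoc', mul_div_assoc', le_div_iff₀ (hσpos i), one_mul] at this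
    rw [hr, div_le_iff₀ (hpw i)]
    refine this.trans (mul_le_mul_of_nonneg_left ?_ hρ.le)
    have : (p : ℝ) * (1 - p) ≤ p := by nlinarith
    exact mul_le_mul_of_nonneg_right this (hwpos i).le
  -- the deviations
  set X : Fin k → Ω → ℝ := fun i ω => (∑ j, S i j ω - p * branchWeight w i) / (p * branchWeight w i)
    with hX
  have hSm : ∀ i, MemLp (fun ω => ∑ j, S i j ω) 2 μ := fun i =>
    memLp_finsetSum _ fun j _ => memLp_of_hasLaw_bernoulliMeasure (hw i) (hlaw i) j
  have hindi : ∀ i, iIndepFun (S i) μ := fun i =>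
    hind.precomp (g := fun j => (i, j)) fun j j' h => (Prod.ext_iff.mp h).2
  have hXlp : ∀ i, MemLp (X i) 2 μ := fun i => by
    simp only [hX, div_eq_inv_mul]
    exact ((hSm i).sub (memLp_const _)).const_mul _
  have hmeanX : ∀ i, μ[X i] = 0 := fun i => by
    rw [hX, integral_div, integral_sub ((hSm i).integrable (by norm_num)) (integrable_const _),
      integral_sum_of_hasLaw_bernoulliMeasure (hw i) (hlaw i)]
    simp [branchWeight]
  have hvarX : ∀ i, Var[X i; μ] = r i ^ 2 := fun i => by
    simp only [hX, div_eq_inv_mul]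
    rw [variance_const_mul, variance_sub_const (hSm i).1,
      variance_sum_of_hasLaw_bernoulliMeasure (hw i) (hlaw i) (hindi i), hr, hσ, div_pow,
      Real.sq_sqrt (hσ2 i).le, inv_pow, inv_mul_eq_div]
  have hindX : Pairwise fun i j => IndepFun (X i) (X j) μ := fun i i' hi =>
    (iIndepFun.indepFun_sum_sum (fun i j => (hlaw i j).aemeasurable) hind hi).comp
      (φ := fun x => (x - p * branchWeight w i) / (p * branchWeight w i))
      (ψ := fun x => (x - p * branchWeight w i') / (p * branchWeight w i'))
      (by fun_prop) (by fun_prop)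
  have hX1 : ∀ i, ∀ᵐ ω ∂μ, -1 ≤ X i ω := fun i => by
    filter_upwards [ae_all_iff.mpr fun j =>
      ae_mem_Icc_of_hasLaw_bernoulliMeasure (hw i j) (hlaw i j)] with ω hω
    have : 0 ≤ ∑ j, S i j ω := Finset.sum_nonneg fun j _ => (hω j).1
    rw [hX, le_div_iff₀ (hpw i)]
    linarith
  have hch : ∀ i t, |t| ≤ T →
      ‖charFun (μ.map fun ω => X i ω / r i) t‖ ≤ Real.exp (a - t ^ 2 / 2) := fun i t ht => by
    have hfun : (fun ω => X i ω / r i) = fun ω => (∑ j, S i j ω - p * ∑ j, w i j) / σ i := by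
      ext ω
      simp only [hX, hr]
      rw [div_div_div_cancel_right₀ (hpw i).ne', branchWeight]
    rw [hfun]
    refine (norm_charFun_sum_of_hasLaw_bernoulliMeasure_le (hlaw i) (hindi i) (σ i) t).trans ?_
    have := hcos _ _ hb (hu i) (hu2 i) ((huδ i).trans (min_le_left _ _)) t ht
    exact Real.exp_le_exp.mpr (by linarith)
  have hQs : ∑ i, Q i ^ 2 ≤ s := by
    simp only [hQ, div_pow]
    rwa [← Finset.sum_div]
  refine (hmain μ Q r X (fun i => (hQpos i).le) hQ1 hQs hrpos hrρ hXlp hmeanX hvarX hindX hX1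
    hch).trans (measureReal_mono ?_)
  rintro ω ⟨hXb, hkl⟩
  have hXb' := abs_le.mp hXb
  have hS : ∀ i, ∑ j, S i j ω = p * W * Q i * (1 + X i ω) := fun i => by
    simp only [hQ, hX]
    have := (hwpos i).ne'
    field_simp
    ring
  have hpW : 0 < p * W := mul_pos hp hWpos
  have h1 : 0 < 1 + ∑ i, Q i * X i ω := by linarith
  have hZ : ∑ i, ∑ j, S i j ω = p * W * (1 + ∑ i, Q i * X i ω) := by
    rw [show p * W * (1 + ∑ i, Q i * X i ω) = p * W * (∑ i, Q i + ∑ i, Q i * X i ω) by rw [hQ1],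
      ← Finset.sum_add_distrib, Finset.mul_sum]
    exact Finset.sum_congr rfl fun i _ => by rw [hS i]; ring
  refine ⟨by rw [hZ]; exact mul_pos hpW h1, ?_⟩
  have hnorm : normalizeVec (branchWeight w) = Q := rfl
  rw [hnorm, funext hS]
  have hid := finiteKL_normalize_mul Q (fun i => X i ω) (p * W) hpW hQpos hQ1 (by linarith)
  rw [← hid, hRM] at hkl
  set M := meanSimpsonRoot w
  refine le_of_mul_le_mul_left (le_trans ?_ hkl) h1
  -- This is where `p ≤ p₀` fixes the constant: `κ (1 - p) ≥ κ (1 - p₀) = 0.05`.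
  have hbound : klLowerBound p w ≤ κ * ((1 - p) / p * M ^ 2) := by
    have hκq : 0.05 ≤ κ * (1 - p) := by
      rw [hκ, div_mul_eq_mul_div, le_div_iff₀ hq₀]
      nlinarith
    rw [klLowerBound, show κ * ((1 - p) / p * M ^ 2) = κ * (1 - p) * M ^ 2 / p by ring]
    gcongr
  have hBnn : 0 ≤ (1 - p) / p * M ^ 2 := by positivity
  calc (1 + ∑ i, Q i * X i ω) * klLowerBound p w
      ≤ (1 + ε) * (κ * ((1 - p) / p * M ^ 2)) :=
        mul_le_mul (by linarith) hbound (by rw [klLowerBound]; positivity) (by linarith)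
    _ = (1 + ε) * κ * ((1 - p) / p * M ^ 2) := by ring
    _ ≤ _ := by
        refine mul_le_mul_of_nonneg_right ?_ hBnn
        have : ε * κ ≤ ε := by nlinarith
        have : κ = 1 / 2 - 5 * ε := by rw [hε]; ring
        linarith

theorem mainTheorem2
    (n : ℕ → ℕ)
    (w : ∀ k : ℕ, Fin k → Fin (n k) → ℝ)
    (hw : ∀ k i j, 0 ≤ w k i j)
    (hw_pos : ∀ k i, 0 < branchWeight (w k) i)
    -- no branch carries a fixed proportion of the total weight in the limit
    (hw_spread : Tendsto (fun k => (∑ i, branchWeight (w k) i ^ 2) / totalWeight (w k) ^ 2)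
      atTop (𝓝 0))
    (p : ℕ → unitInterval)
    (hp_pos : ∀ k, 0 < (p k : ℝ))
    (p₀ : ℝ) (hp₀ : p₀ < 9 / 10) (hp : ∀ k, (p k : ℝ) ≤ p₀)
    (δ : ℝ) (hδ : 0 < δ)
    -- Lyapunov's condition, uniformly in the branch
    (hLyapunov : ∀ ε : ℝ, 0 < ε → ∀ᶠ k in atTop, ∀ i, lyapunovRatio δ (p k) (w k i) ≤ ε)
    {Ω : ℕ → Type*} [∀ k, MeasurableSpace (Ω k)]
    (μ : ∀ k, Measure (Ω k)) [∀ k, IsProbabilityMeasure (μ k)]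
    (S : ∀ k : ℕ, Fin k → Fin (n k) → Ω k → ℝ)
    (hS_law : ∀ k i j, HasLaw (S k i j) (bernoulliMeasure (w k i j) 0 (p k)) (μ k))
    (hS_indep : ∀ k, iIndepFun (fun ij : Fin k × Fin (n k) => S k ij.1 ij.2) (μ k)) :
    -- with probability tending to one, `P` is defined and the divergence is at least the bound
    Tendsto (fun k => (μ k).real {ω |
        0 < ∑ i, ∑ j, S k i j ω ∧
        klLowerBound (p k) (w k) ≤
          finiteKL (normalizeVec fun i => ∑ j, S k i j ω) (normalizeVec (branchWeight (w k)))})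
      atTop (𝓝 1) ∧
    -- the bound is smallest for uniform weights
    ∀ k, 0 < k →
      klLowerBound (p k) (w k) ≥ 0.05 / (n k * p k) ∧
      ∀ c : ℝ, 0 < c →
        klLowerBound (p k) (fun (_ : Fin k) (_ : Fin (n k)) => c) = 0.05 / (n k * p k) := by
  refine ⟨?_, fun k hk => ⟨klLowerBound_ge hk (hw_pos k) (hp_pos k), fun c hc =>
    klLowerBound_const hk (card_pos_of_branchWeight_pos ⟨0, hk⟩ (hw_pos k _)) _ hc⟩⟩
  rw [tendsto_order]
  refine ⟨fun b hb => ?_, fun b hb => Eventually.of_forall fun k =>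
    measureReal_le_one.trans_lt hb⟩
  -- With `θ = (1 - b) / 4` the guaranteed probability `1 - 3θ = (1 + 3b) / 4` exceeds `b`.
  obtain ⟨e, s, he, hs, hmain⟩ := exists_le_measureReal_klLowerBound hδ hp₀
    (show 0 < (1 - b) / 4 by linarith)
  filter_upwards [hLyapunov e he, hw_spread.eventually (ge_mem_nhds hs),
    eventually_gt_atTop 0] with k hk hk' hk0
  refine lt_of_lt_of_le ?_ (hmain (μ k) (w k) (p k) (S k) hk0 (hw k) (hw_pos k) (hp_pos k) (hp k)
    hk' hk (hS_law k) (hS_indep k))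
  linarith
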